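/- A $d$-dimensional cellular automaton with finite state set $S$ consists of a finite neighbourhood $N \subset \mathbb{Z}^d$ and a local rule $f : S^N \to S$; its global map $F : S^{\mathbb{Z}^d} \to S^{\mathbb{Z}^d}$ is $F(x)_v = f\big((x_{v+n})_{n\in N}\big)$. Fix a designated blank state $0 \in S$. A configuration is finite if all but finitely many of its cells are in state $0$. The automaton is nilpotent on finite configurations if the blank state is quiescent ($F(0^{\mathbb{Z}^d}) = 0^{\mathbb{Z}^d}$) and for every finite configuration $x$ there is $n \in \mathbb{N}$ (which may depend on $x$) with $F^n(x) = 0^{\mathbb{Z}^d}$. Cellular automata are given as inputs by finite descriptions: the number of states (the states being $0,\dots,k$), the list of neighbourhood vectors, and a table of the local rule. **Corollary (finite nilpotency).** For every dimension $d \ge 1$, the problem of deciding whether a given $d$-dimensional cellular automaton is nilpotent on finite configurations is $\Pi^0_2$-complete (under computable many-one reductions). The same holds for the problem in which the dimension $d \ge 1$ is part of the input. -/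

import Mathlib

/-- A `d`-dimensional cellular automaton with finite state set `S`: a finite neighbourhood in `ℤ ^ d` and
a local transition function. -/
structure CellularAutomaton (d : ℕ) (S : Type) [Finite S] where
  nbhd : Finset (Fin d → ℤ)
  rule : (nbhd → S) → S

namespace CellularAutomaton

/-- The global map on configurations. -/
def globalMap {d : ℕ} {S : Type} [Finite S] (G : CellularAutomaton d S) (x : (Fin d → ℤ) → S) :
    (Fin d → ℤ) → S :=
  fun v => G.rule fun n => x (v + n.1)

/-- The configuration `x` is finite: all but finitely many cells are in the blank state `b`. -/
def IsFiniteConfig {d : ℕ} {S : Type} (b : S) (x : (Fin d → ℤ) → S) : Prop :=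
  {v | x v ≠ b}.Finite

/-- `G` is nilpotent on finite configurations, with respect to the state `b`: the state `b` is
quiescent, and every finite configuration is mapped to the blank configuration after some number of
steps (which may depend on the configuration). -/
def FinitelyNilpotent {d : ℕ} {S : Type} [Finite S] (G : CellularAutomaton d S) (b : S) : Prop :=
  (G.globalMap (fun _ => b) = fun _ => b) ∧
    ∀ x : (Fin d → ℤ) → S, IsFiniteConfig b x → ∃ n : ℕ, G.globalMap^[n] x = fun _ => b

end CellularAutomaton

/-- A finite description of a cellular automaton, as the input of a decision problem:
`(k, N, T)` where the states are `0, …, k` (with `0` the blank state), `N` lists the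
neighbourhood vectors, and the table `T` lists pairs of a pattern (the states read at the
vectors of `N`, in order) and the resulting state. -/
abbrev CACode : Type := ℕ × List (List ℤ) × List (List ℕ × ℕ)

namespace CACode

/-- The vector of `ℤ ^ d` listed by `l` (cut off, or padded by zeros, at length `d`). -/
def vec (d : ℕ) (l : List ℤ) : Fin d → ℤ := fun i => l.getD i.1 0

/-- The state that the table `T` assigns to a pattern: the first entry for that pattern counts,
and patterns that are not listed go to the blank state. -/
def next (k : ℕ) (T : List (List ℕ × ℕ)) (w : List ℕ) : Fin (k + 1) :=
  Fin.ofNat (k + 1) ((T.lookup w).getD 0)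

/-- The `d`-dimensional cellular automaton with the description `c`. -/
def toCA (d : ℕ) (c : CACode) : CellularAutomaton d (Fin (c.1 + 1)) where
  nbhd := (c.2.1.map (vec d)).toFinset
  rule u := next c.1 c.2.2 <| c.2.1.attach.map fun l =>
    (u ⟨vec d l.1, List.mem_toFinset.2 (List.mem_map_of_mem l.2)⟩).val

/-- Every cellular automaton with states `0, …, k` has a description. -/
theorem exists_code (d k : ℕ) (G : CellularAutomaton d (Fin (k + 1))) :
    ∃ (N : List (List ℤ)) (T : List (List ℕ × ℕ)),
      (toCA d (k, N, T)).nbhd = G.nbhd ∧ (toCA d (k, N, T)).globalMap = G.globalMap := by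
  classical
  have hvec : ∀ v : Fin d → ℤ, vec d (List.ofFn v) = v := by
    intro v; funext i; simp [vec]
  have hlook : ∀ (g : (G.nbhd → Fin (k + 1)) → List ℕ) (_ : Function.Injective g)
      (h : (G.nbhd → Fin (k + 1)) → ℕ) (u : G.nbhd → Fin (k + 1))
      (L : List (G.nbhd → Fin (k + 1))), u ∈ L →
      (L.map fun u => (g u, h u)).lookup (g u) = some (h u) := by
    intro g hg h u L
    induction L with
    | nil => simp
    | cons a L ih =>
      intro hu
      by_cases hua : u = a
      · subst hua; simp
      · have hne : g u ≠ g a := fun e => hua (hg e)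
        have hb : (g u == g a) = false := by simpa using hne
        rcases List.mem_cons.1 hu with h' | h'
        · exact absurd h' hua
        · simp [List.lookup, hb, ih h']
  let pat : (G.nbhd → Fin (k + 1)) → List ℕ := fun u => G.nbhd.toList.attach.map fun n =>
    (u ⟨n.1, Finset.mem_toList.1 n.2⟩).val
  have hpat : Function.Injective pat := by
    intro u u' e
    funext n
    have := (List.map_inj_left.1 e) ⟨n.1, Finset.mem_toList.2 n.2⟩ (List.mem_attach _ _)
    exact Fin.ext this
  refine ⟨G.nbhd.toList.map List.ofFn,
    (Finset.univ : Finset (G.nbhd → Fin (k + 1))).toList.map fun u => (pat u, (G.rule u).val),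
    ?_, ?_⟩
  · ext v
    simp [toCA, hvec]
  · funext x v
    have key := hlook pat hpat (fun u => (G.rule u).val) (fun n => x (v + n.1)) _
      (Finset.mem_toList.2 (Finset.mem_univ _))
    have hp : ((G.nbhd.toList.map List.ofFn).attach.map fun l => (x (v + vec d l.1)).val)
        = pat (fun n => x (v + n.1)) := by
      have h1 : ∀ L : List (List ℤ), (L.attach.map fun l => (x (v + vec d l.1)).val)
          = L.map fun l => (x (v + vec d l)).val := fun L =>
        List.attach_map_val (l := L) (f := fun l => (x (v + vec d l)).val)
      have h2 : pat (fun n => x (v + n.1)) = G.nbhd.toList.map fun n => (x (v + n)).val :=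
        List.attach_map_val (l := G.nbhd.toList) (f := fun n => (x (v + n)).val)
      rw [h1, h2, List.map_map]
      refine List.map_congr_left fun n _ => ?_
      simp [hvec]
    change next k _ ((G.nbhd.toList.map List.ofFn).attach.map
      fun l => (x (v + vec d l.1)).val) = G.rule fun n => x (v + n.1)
    rw [hp, next, key]
    exact Fin.ext (Nat.mod_eq_of_lt (G.rule _).isLt)

end CACode

/-- `p` is a `Π⁰₂` predicate: `p a ↔ ∀ m, ∃ n, R a m n` for a computable relation `R`. -/
def IsPi02 {α : Type} [Primcodable α] (p : α → Prop) : Prop :=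
  ∃ R : α × ℕ × ℕ → Prop, ComputablePred R ∧ ∀ a, p a ↔ ∀ m, ∃ n, R (a, m, n)

/-- `p` is `Π⁰₂`-complete: it is `Π⁰₂`, and every `Π⁰₂` set of natural numbers is many-one
reducible to it. -/
def IsPi02Complete {α : Type} [Primcodable α] (p : α → Prop) : Prop :=
  IsPi02 p ∧ ∀ q : ℕ → Prop, IsPi02 q → q ≤₀ p

/-!
Membership in `Π⁰₂` is a simulation: finite configurations are coded by lists of places with states,
on which a step of the automaton is primitive recursive (`CACode.conf_stepList`), so finite
nilpotency says that the blank state is quiescent, which is decidable, and that every list is turned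
into a blank one after some number of steps (`CACode.finitelyNilpotent_iff`).

For hardness, a `Π⁰₂` set has the form `∀ m, ∃ n, f (a, m, n) ≠ 0` with `f` primitive recursive and
the condition monotone in `n` (`IsPi02.exists_primrec'`). For given `a`, a cellular automaton is
needed whose finite configurations all die out if and only if each `m` has such an `n`. The
difficulty is that arbitrary finite configurations have to die, and not only those that occur in a
computation. This is dealt with on three levels.

* Counter programs. Since `f` is primitive recursive, it is computed by a loop program
  (`LoopProg.exists_computes`), and the compiled program reaches its exit from every place and with
  every register contents (`LoopProg.exists_leads_exit`). The program `LoopProg.searchProgram` tests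
  `f (a, m, n) ≠ 0` for increasing `n`, and sets all data but `m` and `n` afresh in each round.
  From any configuration it thus gets into a proper search for some `m`, and by monotonicity it does
  not matter at which `n` that search begins. So it halts from all configurations if and only if
  each `m` has an `n` (`LoopProg.halts_searchProgram`, `LoopProg.not_halts_searchProgram`).

* Sweeping automata. The registers are stored in a word, register `i` as the number of letters
  `i + 1`, and a head sweeps back and forth over the word and changes one letter or appends one
  letter in each sweep. Every word is the code of some register contents, so halting from all
  configurations carries over (`Program.halts_sweeper_of_forall_halts`,
  `Program.halts_of_halts_sweeper`).

* Cellular automata. Each cell of a word knows in which direction the head of the word lies, and it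
  dies when it is not next to a cell of the same kind or to a head on that side. A head dies when it
  meets a foreign word. Heads arise only from heads, so their number never increases, and a head
  that survives carries out the steps of the sweeping automaton (`Sweeper.Rep.evolve`). If the
  sweeping automaton always halts, the number of heads drops until none is left, and then all words
  decay (`Sweeper.exists_iterate_eq_blank`). If it does not halt on some word, that word alone
  lives forever (`Sweeper.iterate_ne_blank`).

The cellular automaton acts along the first coordinate only, and its description does not depend on
the dimension, so that one reduction serves for all dimensions and for the uniform problem.
-/

/-! ### Sweeping automata and the cellular automata that run them -/

/-- A sweeping automaton: a head sweeps back and forth over a finite word. At each letter `t` it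
applies `pass`, which changes its state and the letter; at the end of the word it applies `turn`,
which either halts (`none`) or gives the state for the sweep back, possibly together with a letter
to be appended to the word. -/
structure Sweeper (Q Γ : Type) where
  pass : Q → Γ → Q × Γ
  turn : Q → Option (Q × Option Γ)

/-- A configuration of a sweeping automaton: the state, the letter under the head, the letters
ahead of the head and those behind it (nearest letters first). -/
abbrev SweepCfg (Q Γ : Type) : Type := Q × Γ × List Γ × List Γ

/-- The cells of the cellular automaton that runs a sweeping automaton. Directions are booleans,
`true` for the positive one. A cell `tape s t` holds the letter `t` and finds the head of its word
in direction `s`; a cell `head d q t` holds the letter `t` under a head that moves in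
direction `d`. -/
inductive Cell (Q Γ : Type) : Type
  | blank
  | tape (s : Bool) (t : Γ)
  | head (d : Bool) (q : Q) (t : Γ)
  deriving DecidableEq

namespace Cell

variable {Q Γ : Type}

/-- The cell carries a head. -/
def IsHead (c : Cell Q Γ) : Prop := ∃ d q t, c = head d q t

@[simp] theorem isHead_head (d : Bool) (q : Q) (t : Γ) : (head d q t).IsHead := ⟨d, q, t, rfl⟩

@[simp] theorem not_isHead_blank : ¬ (blank : Cell Q Γ).IsHead := by rintro ⟨d, q, t, h⟩; cases h

@[simp] theorem not_isHead_tape (s : Bool) (t : Γ) : ¬ (tape s t : Cell Q Γ).IsHead := by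
  rintro ⟨d, q, t, h⟩; cases h

end Cell

namespace Sweeper

open Cell

variable {Q Γ : Type} (M : Sweeper Q Γ)

/-- One step of a sweeping automaton. -/
def step : SweepCfg Q Γ → Option (SweepCfg Q Γ)
  | (q, t, u :: as, bs) => some ((M.pass q t).1, u, as, (M.pass q t).2 :: bs)
  | (q, t, [], bs) =>
    match M.turn (M.pass q t).1 with
    | none => none
    | some (q', none) => some (q', (M.pass q t).2, bs, [])
    | some (q', some u) => some (q', u, (M.pass q t).2 :: bs, [])

/-- The cell that a neighbouring head moving in direction `d` creates on a blank cell. -/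
def grow (d : Bool) : Cell Q Γ → Option (Cell Q Γ)
  | head d' q t =>
    if d' = d then
      match M.turn (M.pass q t).1 with
      | some (q', some u) => some (head (!d) q' u)
      | _ => none
    else none
  | _ => none

/-- The local rule: the new content of a cell in terms of its two neighbours `nb false`, `nb true`
and its present content. Tape cells that have lost their head die out, and a head dies when it meets
anything but its own word or a blank cell. -/
def next (nb : Bool → Cell Q Γ) : Cell Q Γ → Cell Q Γ
  | blank =>
    match M.grow true (nb false), M.grow false (nb true) with
    | some c, none => c
    | none, some c => c
    | _, _ => blank
  | tape s t =>
    match nb s with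
    | blank => blank
    | tape s' _ => if s' = s then tape s t else blank
    | head d q u => if d = s then tape s t else head d (M.pass q u).1 t
  | head d q t =>
    match nb d with
    | blank =>
      match M.turn (M.pass q t).1 with
      | none => blank
      | some (q', none) => head (!d) q' (M.pass q t).2
      | some (_, some _) => tape d (M.pass q t).2
    | tape s _ => if s = d then blank else tape d (M.pass q t).2
    | head _ _ _ => blank

variable {A : Type} [AddCommGroup A] (e : A)

/-- The unit step in direction `d` along `e`. -/
def dir (d : Bool) : A := if d then e else -e

@[simp] theorem dir_not (d : Bool) : dir e (!d) = -dir e d := by cases d <;> simp [dir]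

/-- The global map of the cellular automaton of `M`, acting along `e` on configurations over a
group. -/
def evolve (x : A → Cell Q Γ) (v : A) : Cell Q Γ := M.next (fun d => x (v + dir e d)) (x v)

variable {M e}

theorem evolve_tape {x : A → Cell Q Γ} {v : A} {s : Bool} {t : Γ} (h : x v = tape s t) :
    M.evolve e x v = match x (v + dir e s) with
      | blank => blank
      | tape s' _ => if s' = s then tape s t else blank
      | head d q u => if d = s then tape s t else head d (M.pass q u).1 t := by
  simp [evolve, h, next]

theorem evolve_head {x : A → Cell Q Γ} {v : A} {d : Bool} {q : Q} {t : Γ} (h : x v = head d q t) :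
    M.evolve e x v = match x (v + dir e d) with
      | blank =>
        match M.turn (M.pass q t).1 with
        | none => blank
        | some (q', none) => head (!d) q' (M.pass q t).2
        | some (_, some _) => tape d (M.pass q t).2
      | tape s _ => if s = d then blank else tape d (M.pass q t).2
      | head _ _ _ => blank := by
  simp [evolve, h, next]

theorem evolve_blank {x : A → Cell Q Γ} {v : A} (h : x v = blank) (d : Bool) :
    M.evolve e x v = match M.grow d (x (v - dir e d)), M.grow (!d) (x (v + dir e d)) with
      | some c, none => c
      | none, some c => c
      | _, _ => blank := by
  cases d
  · simp only [evolve, h, next, dir, sub_eq_add_neg]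
    simp only [Bool.not_false, Bool.false_eq_true, if_false, if_true, neg_neg]
    split <;> split <;> simp_all
  · simp [evolve, h, next, dir, sub_eq_add_neg]

theorem grow_isHead {d : Bool} {c c' : Cell Q Γ} (h : M.grow d c = some c') : c'.IsHead := by
  unfold grow at h
  split at h
  · split_ifs at h
    split at h <;> simp at h
    exact h ▸ isHead_head ..
  · simp at h

/-- A blank cell either stays blank or receives a head. -/
theorem evolve_blank_ne_tape {x : A → Cell Q Γ} {v : A} (h : x v = blank) (s : Bool) (t : Γ) :
    M.evolve e x v ≠ tape s t := by
  rw [evolve_blank h true]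
  intro h'
  split at h'
  · next h1 _ => exact absurd (grow_isHead h1) (h' ▸ not_isHead_tape s t)
  · next h1 => exact absurd (grow_isHead h1) (h' ▸ not_isHead_tape s t)
  · cases h'

theorem evolve_const_blank : M.evolve e (fun _ => blank) = fun _ => blank := by
  funext v; rw [evolve_blank rfl true]; simp [grow]

/-! ### Following a head -/

variable (M e) in
/-- The place to which the head at `v` tries to move. -/
def target (x : A → Cell Q Γ) (v : A) : A :=
  match x v with
  | head d q t =>
    match x (v + dir e d) with
    | blank =>
      match M.turn (M.pass q t).1 with
      | some (_, some _) => v + dir e d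
      | _ => v
    | tape s _ => if s = d then v else v + dir e d
    | head _ _ _ => v
  | _ => v

/-- Every head comes from a head. -/
theorem exists_target_eq {x : A → Cell Q Γ} {w : A} (h : (M.evolve e x w).IsHead) :
    ∃ v, (x v).IsHead ∧ M.target e x v = w := by
  have key : ∀ d c, x w = blank → M.grow d (x (w - dir e d)) = some c →
      ∃ v, (x v).IsHead ∧ M.target e x v = w := by
    intro d c hb hg
    refine ⟨w - dir e d, ?_⟩
    unfold grow at hg
    split at hg
    · next d' q t hx =>
      split_ifs at hg with hd
      subst hd
      split at hg <;> simp at hg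
      next q' u hq => simp [target, hx, hb, hq]
    · simp at hg
  cases hw : x w with
  | blank =>
    rw [evolve_blank hw true] at h
    split at h
    · next h1 _ => exact key _ _ hw h1
    · next h1 => exact key false _ hw (by simpa [dir, sub_eq_add_neg] using h1)
    · simp at h
  | tape s t =>
    rw [evolve_tape hw] at h
    split at h
    · simp at h
    · split_ifs at h <;> simp at h
    · next d q u hx =>
      split_ifs at h with hd
      · simp at h
      · have hds : s = !d := by cases d <;> cases s <;> simp_all
        subst hds
        refine ⟨w + dir e (!d), by rw [hx]; exact isHead_head .., ?_⟩
        simp only [dir_not] at hx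
        simp [target, hx, hw]
  | head d q t =>
    refine ⟨w, by simp [hw], ?_⟩
    rw [evolve_head hw] at h
    split at h
    · next hx =>
      split at h <;> simp_all [target]
    · next s u hx =>
      split_ifs at h <;> simp at h
    · simp at h

/-- The set of places with a head. -/
def heads (x : A → Cell Q Γ) : Set A := {v | (x v).IsHead}

theorem heads_evolve_subset (x : A → Cell Q Γ) :
    heads (M.evolve e x) ⊆ M.target e x '' heads x := fun _ hw =>
  let ⟨v, hv, h⟩ := exists_target_eq hw; ⟨v, hv, h⟩

theorem heads_evolve_finite {x : A → Cell Q Γ} (hx : (heads x).Finite) :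
    (heads (M.evolve e x)).Finite :=
  (hx.image _).subset (heads_evolve_subset x)

/-- If the head at `v` gets lost, the number of heads drops. -/
theorem ncard_heads_evolve_lt {x : A → Cell Q Γ} (hx : (heads x).Finite) {v : A}
    (hv : (x v).IsHead) (hl : ¬ (M.evolve e x (M.target e x v)).IsHead) :
    (heads (M.evolve e x)).ncard < (heads x).ncard := by
  have hsub : heads (M.evolve e x) ⊆ M.target e x '' (heads x \ {v}) := by
    intro w hw
    obtain ⟨u, hu, rfl⟩ := exists_target_eq hw
    refine ⟨u, ⟨hu, ?_⟩, rfl⟩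
    rintro rfl
    exact hl hw
  calc (heads (M.evolve e x)).ncard ≤ (M.target e x '' (heads x \ {v})).ncard :=
        Set.ncard_le_ncard hsub (hx.sdiff.image _)
    _ ≤ (heads x \ {v}).ncard := Set.ncard_image_le hx.sdiff
    _ < (heads x).ncard := Set.ncard_sdiff_singleton_lt_of_mem hv hx

theorem ncard_heads_evolve_le {x : A → Cell Q Γ} (hx : (heads x).Finite) :
    (heads (M.evolve e x)).ncard ≤ (heads x).ncard :=
  (Set.ncard_le_ncard (heads_evolve_subset x) (hx.image _)).trans (Set.ncard_image_le hx)

variable (e) in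
/-- From `v` in direction `d`, the configuration `x` shows tape cells with the letters of the list,
all pointing back to `v`, and then a place where the end condition `E` holds. -/
def Side (E : A → Bool → Prop) (x : A → Cell Q Γ) : List Γ → A → Bool → Prop
  | [], v, d => E v d
  | t :: L, v, d => x (v + dir e d) = tape (!d) t ∧ Side E x L (v + dir e d) d

/-- An end condition that survives one step of the automaton as long as the head of the word
survives. -/
structure EndCondition (M : Sweeper Q Γ) (e : A) (E : (A → Cell Q Γ) → A → Bool → Prop) :
    Prop where
  not_tape : ∀ {x v d}, E x v d → ∀ t, x (v + dir e d) ≠ tape (!d) t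
  inward : ∀ {x v d}, ((∃ t, x v = tape (!d) t) ∨ ∃ q t, x v = head (!d) q t) → E x v d →
    E (M.evolve e x) v d
  turn : ∀ {x v d q t q'}, x v = head d q t → x (v + dir e d) = blank →
    M.turn (M.pass q t).1 = some (q', none) → E x v d → E (M.evolve e x) v d
  extend : ∀ {x v d q t q' u}, x v = head d q t → x (v + dir e d) = blank →
    M.turn (M.pass q t).1 = some (q', some u) → (M.evolve e x (v + dir e d)).IsHead →
    E x v d → E (M.evolve e x) (v + dir e d) d

/-- Beyond `v` in direction `d` a word is unchanged, unless a head at `v` moves in that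
direction. -/
theorem side_evolve {E : (A → Cell Q Γ) → A → Bool → Prop} (hE : EndCondition M e E)
    {x : A → Cell Q Γ} {L : List Γ} {v : A} {d : Bool}
    (hv : (∃ t, x v = tape (!d) t) ∨ ∃ q t, x v = head (!d) q t) (h : Side e (E x) x L v d) :
    Side e (E (M.evolve e x)) (M.evolve e x) L v d := by
  induction L generalizing v with
  | nil => exact hE.inward hv h
  | cons t L ih =>
    refine ⟨?_, ih (.inl ⟨t, h.1⟩) h.2⟩
    rw [evolve_tape h.1]
    rcases hv with ⟨u, hu⟩ | ⟨q, u, hu⟩ <;> simp [hu]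

variable (e) in
/-- The head at `v` with direction `d` belongs to a word that represents `c`. -/
def Rep (E : (A → Cell Q Γ) → A → Bool → Prop) (x : A → Cell Q Γ) (v : A) (d : Bool)
    (c : SweepCfg Q Γ) : Prop :=
  x v = head d c.1 c.2.1 ∧ Side e (E x) x c.2.2.1 v d ∧ Side e (E x) x c.2.2.2 v (!d)

/-- A head that survives a step of the cellular automaton carries out a step of the sweeping
automaton. -/
theorem Rep.evolve {E : (A → Cell Q Γ) → A → Bool → Prop} (hE : EndCondition M e E)
    {x : A → Cell Q Γ} {v : A} {d : Bool} {c : SweepCfg Q Γ} (h : Rep e E x v d c)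
    (hs : (M.evolve e x (M.target e x v)).IsHead) :
    ∃ c', M.step c = some c' ∧ ∃ d', Rep e E (M.evolve e x) (M.target e x v) d' c' := by
  obtain ⟨q, t, as, bs⟩ := c
  obtain ⟨hv, ha, hb⟩ := h
  simp only at hv ha hb
  have hb' : Side e (E (M.evolve e x)) (M.evolve e x) bs v (!d) :=
    side_evolve hE (.inr ⟨q, t, by simpa using hv⟩) hb
  cases as with
  | cons u as =>
    obtain ⟨ha1, ha2⟩ := ha
    have ht : M.target e x v = v + dir e d := by simp [target, hv, ha1]
    rw [ht]
    refine ⟨_, rfl, d, ?_, side_evolve hE (.inl ⟨u, ha1⟩) ha2, ?_, ?_⟩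
    · rw [evolve_tape ha1]; simp [hv]
    · simp [evolve_head hv, ha1]
    · simpa using hb'
  | nil =>
    have hnt := hE.not_tape ha
    cases hc : x (v + dir e d) with
    | head d' q' t' =>
      have ht : M.target e x v = v := by simp [target, hv, hc]
      rw [ht, evolve_head hv] at hs
      simp [hc] at hs
    | tape s u =>
      have hsd : s = d := by
        by_contra hne
        exact hnt u (by rw [hc]; cases s <;> cases d <;> simp_all)
      have ht : M.target e x v = v := by simp [target, hv, hc, hsd]
      rw [ht, evolve_head hv] at hs
      simp [hc, hsd] at hs
    | blank =>
      rcases hq : M.turn (M.pass q t).1 with _ | ⟨q', _ | u⟩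
      · have ht : M.target e x v = v := by simp [target, hv, hc, hq]
        rw [ht, evolve_head hv] at hs
        simp [hc, hq] at hs
      · have ht : M.target e x v = v := by simp [target, hv, hc, hq]
        rw [ht] at hs ⊢
        refine ⟨(q', (M.pass q t).2, bs, []), by simp [step, hq], !d, ?_, hb', ?_⟩
        · simp [evolve_head hv, hc, hq]
        · simpa [Side] using hE.turn hv hc hq ha
      · have ht : M.target e x v = v + dir e d := by simp [target, hv, hc, hq]
        rw [ht] at hs ⊢
        refine ⟨(q', u, (M.pass q t).2 :: bs, []), by simp [step, hq], !d, ?_, ⟨?_, ?_⟩, ?_⟩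
        · have hg : M.grow d (x v) = some (head (!d) q' u) := by simp [grow, hv, hq]
          rw [evolve_blank hc d, add_sub_cancel_right, hg] at hs ⊢
          split at hs <;> simp_all
        · simp [evolve_head hv, hc, hq]
        · simpa using hb'
        · simpa [Side] using hE.extend hv hc hq hs ha

variable (e) in
/-- The word does not continue at `v` in direction `d`. -/
def Ends (x : A → Cell Q Γ) (v : A) (d : Bool) : Prop := ∀ t, x (v + dir e d) ≠ tape (!d) t

variable (e) in
/-- All cells beyond `v` in direction `d` are blank. -/
def EndsBlank (x : A → Cell Q Γ) (v : A) (d : Bool) : Prop :=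
  ∀ n : ℕ, x (v + (n + 1) • dir e d) = blank

theorem EndsBlank.blank {x : A → Cell Q Γ} {v : A} {d : Bool} (h : EndsBlank e x v d) :
    x (v + dir e d) = .blank := by simpa using h 0

theorem endCondition_ends : EndCondition M e (Ends e) where
  not_tape h := h
  inward {x v d} hv h t := by
    cases hc : x (v + dir e d) with
    | blank => exact evolve_blank_ne_tape hc _ _
    | tape s u =>
      rw [evolve_tape hc]
      have hs : s ≠ !d := by rintro rfl; exact h u hc
      split
      · simp
      · split_ifs <;> simp [hs]
      · split_ifs <;> simp [hs]
    | head d' q u =>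
      rw [evolve_head hc]
      by_cases hd : d' = !d
      · subst hd
        rcases hv with ⟨u', hu⟩ | ⟨q', u', hu⟩ <;> simp [hu]
      · split
        · split <;> simp [hd]
        · split_ifs <;> simp [hd]
        · simp
  turn _ hc _ _ := evolve_blank_ne_tape hc _
  extend {x v d q t q' u} hv hc hq hs _ t' := by
    cases hw : x (v + dir e d + dir e d) with
    | blank => exact evolve_blank_ne_tape hw _ _
    | tape s u' =>
      rw [evolve_tape hw]
      by_cases hsd : s = !d
      · subst hsd; simp [hc]
      · split
        · simp
        · split_ifs <;> simp [hsd]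
        · split_ifs <;> simp [hsd]
    | head d' q'' u' =>
      rw [evolve_head hw]
      by_cases hd : d' = !d
      · subst hd
        have hg : M.grow d (x v) = some (head (!d) q' u) := by simp [grow, hv, hq]
        rw [evolve_blank hc d, add_sub_cancel_right, hg] at hs
        rcases hq' : M.turn (M.pass q'' u').1 with _ | ⟨q3, _ | u3⟩
        · simp [hc]
        · simp [hc]
        · simp [hw, grow, hq'] at hs
      · split
        · split <;> simp [hd]
        · split_ifs <;> simp [hd]
        · simp

theorem evolve_eq_blank_of {x : A → Cell Q Γ} {v : A} (d : Bool) (h : x v = blank)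
    (h1 : M.grow d (x (v - dir e d)) = none) (h2 : x (v + dir e d) = blank) :
    M.evolve e x v = blank := by
  rw [evolve_blank h d, h1, h2]; simp [grow]

theorem endCondition_endsBlank : EndCondition M e (EndsBlank e) where
  not_tape h t := by simp [h.blank]
  inward {x v d} hv h n := by
    refine evolve_eq_blank_of d (h n) ?_ ?_
    · cases n with
      | zero => rcases hv with ⟨u', hu⟩ | ⟨q', u', hu⟩ <;> simp [grow, hu]
      | succ n =>
        rw [show v + (n + 1 + 1) • dir e d - dir e d = v + (n + 1) • dir e d by
          rw [succ_nsmul]; abel, h n]; simp [grow]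
    · rw [add_assoc, ← succ_nsmul]; exact h (n + 1)
  turn {x v d q t q'} hv _ hq h n := by
    refine evolve_eq_blank_of d (h n) ?_ ?_
    · cases n with
      | zero => simp [grow, hv, hq]
      | succ n =>
        rw [show v + (n + 1 + 1) • dir e d - dir e d = v + (n + 1) • dir e d by
          rw [succ_nsmul]; abel, h n]; simp [grow]
    · rw [add_assoc, ← succ_nsmul]; exact h (n + 1)
  extend {x v d q t q' u} _ _ _ _ h n := by
    have h' : ∀ n : ℕ, v + dir e d + (n + 1) • dir e d = v + (n + 1 + 1) • dir e d := fun n => by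
      rw [succ_nsmul (dir e d) (n + 1)]; abel
    refine evolve_eq_blank_of d (by rw [h']; exact h _) ?_ ?_
    · rw [h', succ_nsmul, ← add_assoc, add_sub_cancel_right, h n]; simp [grow]
    · rw [h', add_assoc, ← succ_nsmul]; exact h (n + 1 + 1)

/-- On an otherwise blank line, a head gets lost only by halting. -/
theorem Rep.isHead_target {x : A → Cell Q Γ} {v : A} {d : Bool} {c c' : SweepCfg Q Γ}
    (h : Rep e (EndsBlank e) x v d c) (hc : M.step c = some c') :
    (M.evolve e x (M.target e x v)).IsHead := by
  obtain ⟨q, t, as, bs⟩ := c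
  obtain ⟨hv, ha, hb⟩ := h
  simp only at hv ha hb
  cases as with
  | cons u as =>
    have ht : M.target e x v = v + dir e d := by simp [target, hv, ha.1]
    rw [ht, evolve_tape ha.1]
    simp [hv]
  | nil =>
    have hn : x (v + dir e d) = blank := EndsBlank.blank ha
    rcases hq : M.turn (M.pass q t).1 with _ | ⟨q', _ | u⟩
    · simp [step, hq] at hc
    · have ht : M.target e x v = v := by simp [target, hv, hn, hq]
      rw [ht, evolve_head hv]; simp [hn, hq]
    · have ht : M.target e x v = v + dir e d := by simp [target, hv, hn, hq]
      have hg : M.grow d (x v) = some (head (!d) q' u) := by simp [grow, hv, hq]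
      have hn2 : x (v + dir e d + dir e d) = blank := by
        simpa [two_nsmul, add_assoc, one_add_one_eq_two] using ha 1
      rw [ht, evolve_blank hn d, add_sub_cancel_right, hg, hn2]
      simp [grow]

end Sweeper

/-! ### Extinction -/

/-- The process that starts at `c` and is driven by the partial map `f` comes to a halt. -/
def Halts {σ : Type} (f : σ → Option σ) (c : σ) : Prop := Acc (fun c' c => f c = some c') c

namespace Sweeper

open Cell

variable {Q Γ A : Type}

theorem heads_finite {x : A → Cell Q Γ} (hx : {v | x v ≠ blank}.Finite) : (heads x).Finite :=
  hx.subset fun v hv hb => by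
    rw [heads, Set.mem_ofPred_eq, hb] at hv; exact not_isHead_blank hv

variable {M : Sweeper Q Γ} [AddCommGroup A] {e : A}

theorem injective_nsmul_dir (he : ¬ IsOfFinAddOrder e) (d : Bool) :
    Function.Injective fun n : ℕ => n • dir e d := by
  rw [injective_nsmul_iff_not_isOfFinAddOrder]
  cases d
  · simpa [dir] using he
  · simpa [dir] using he

theorem finite_evolve {x : A → Cell Q Γ} (hx : {v | x v ≠ blank}.Finite) :
    {v | M.evolve e x v ≠ blank}.Finite := by
  refine (hx.union (heads_evolve_finite (M := M) (e := e) (heads_finite hx))).subset fun v hv => ?_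
  by_cases hb : x v = blank
  · right
    cases hc : M.evolve e x v with
    | blank => exact absurd hc hv
    | tape s t => exact absurd hc (evolve_blank_ne_tape hb s t)
    | head d q t => simp [heads, hc]
  · exact .inl hb

theorem finite_iterate_evolve {x : A → Cell Q Γ} (hx : {v | x v ≠ blank}.Finite) (n : ℕ) :
    {v | (M.evolve e)^[n] x v ≠ blank}.Finite := by
  induction n with
  | zero => exact hx
  | succ n ih => rw [Function.iterate_succ_apply']; exact finite_evolve ih

/-- In a finite configuration every run of tape cells ends. -/
theorem exists_side (he : ¬ IsOfFinAddOrder e) {x : A → Cell Q Γ}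
    (hx : {v | x v ≠ blank}.Finite) (v : A) (d : Bool) : ∃ L, Side e (Ends e x) x L v d := by
  have hn : ∃ n : ℕ, x (v + (n + 1) • dir e d) = blank := by
    by_contra! h
    refine Set.infinite_range_of_injective (f := fun n : ℕ => v + (n + 1) • dir e d) ?_
      (hx.subset ?_)
    · intro m n hmn
      simpa using injective_nsmul_dir he d (add_left_cancel hmn)
    · rintro _ ⟨n, rfl⟩; exact h n
  obtain ⟨n, hn⟩ := hn
  induction n generalizing v with
  | zero => exact ⟨[], fun t => by simp_all⟩
  | succ n ih =>
    by_cases ht : ∃ t, x (v + dir e d) = tape (!d) t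
    · obtain ⟨t, ht⟩ := ht
      obtain ⟨L, hL⟩ := ih (v + dir e d) (by
        rwa [add_assoc, ← succ_nsmul'])
      exact ⟨t :: L, ht, hL⟩
    · exact ⟨[], fun t h => ht ⟨t, h⟩⟩

/-- If the sweeping automaton halts from the configuration seen by some head, then the number of
heads drops: either that head halts, or it gets lost on the way. -/
theorem exists_ncard_heads_lt {c : SweepCfg Q Γ} (hc : Halts M.step c) :
    ∀ {x : A → Cell Q Γ} {v : A} {d : Bool}, (heads x).Finite → Rep e (Ends e) x v d c →
      ∃ n, (heads ((M.evolve e)^[n] x)).ncard < (heads x).ncard := by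
  induction hc with
  | intro c _ ih =>
    intro x v d hx hr
    have hv : (x v).IsHead := by rw [hr.1]; exact isHead_head ..
    by_cases hs : (M.evolve e x (M.target e x v)).IsHead
    · obtain ⟨c', hc', d', hr'⟩ := hr.evolve endCondition_ends hs
      obtain ⟨n, hn⟩ := ih c' hc' (heads_evolve_finite hx) hr'
      exact ⟨n + 1, by
        rw [Function.iterate_succ_apply]; exact hn.trans_le (ncard_heads_evolve_le hx)⟩
    · exact ⟨1, ncard_heads_evolve_lt hx hv hs⟩

theorem exists_heads_eq_empty (he : ¬ IsOfFinAddOrder e) (hM : ∀ c, Halts M.step c)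
    {x : A → Cell Q Γ} (hx : {v | x v ≠ blank}.Finite) :
    ∃ n, heads ((M.evolve e)^[n] x) = ∅ := by
  induction hk : (heads x).ncard using Nat.strong_induction_on generalizing x with
  | _ k ih =>
    rcases (heads x).eq_empty_or_nonempty with h0 | ⟨v, d, q, t, hv⟩
    · exact ⟨0, h0⟩
    · obtain ⟨as, has⟩ := exists_side he hx v d
      obtain ⟨bs, hbs⟩ := exists_side he hx v (!d)
      obtain ⟨n, hn⟩ := exists_ncard_heads_lt (e := e) (hM (q, t, as, bs)) (heads_finite hx)
        ⟨hv, has, hbs⟩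
      obtain ⟨m, hm⟩ := ih _ (hk ▸ hn) (finite_iterate_evolve hx n) rfl
      exact ⟨m + n, by rwa [Function.iterate_add_apply]⟩

theorem heads_evolve_eq_empty {x : A → Cell Q Γ} (h : heads x = ∅) :
    heads (M.evolve e x) = ∅ := by
  simpa [h] using heads_evolve_subset (M := M) (e := e) x

/-- Without heads, a cell that survives is a tape cell whose neighbour in the direction of the
missing head is one as well. -/
theorem eq_tape_of_evolve_eq_tape {x : A → Cell Q Γ} (h : heads x = ∅) {v : A} {s : Bool} {t : Γ}
    (hv : M.evolve e x v = tape s t) : x v = tape s t ∧ ∃ u, x (v + dir e s) = tape s u := by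
  have hnh : ∀ w d q t, x w ≠ head d q t := fun w d q t hw => by
    have : w ∈ heads x := by simp [heads, hw]
    simp [h] at this
  cases hc : x v with
  | blank => exact absurd hv (evolve_blank_ne_tape hc s t)
  | head d q t => exact absurd hc (hnh _ _ _ _)
  | tape s' t' =>
    rw [evolve_tape hc] at hv
    cases hc' : x (v + dir e s') with
    | blank => simp [hc'] at hv
    | head d q t => exact absurd hc' (hnh _ _ _ _)
    | tape s'' u =>
      by_cases hs : s'' = s'
      · subst hs
        simp only [hc', if_true, tape.injEq] at hv
        obtain ⟨rfl, rfl⟩ := hv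
        exact ⟨rfl, u, hc'⟩
      · simp [hc', hs] at hv

/-- Without heads, a tape cell that survives `n` steps has seen `n` further tape cells in the
direction of its missing head. -/
theorem forall_eq_tape_of_iterate {x : A → Cell Q Γ} (h : heads x = ∅) {n : ℕ} {v : A}
    {s : Bool} {t : Γ} (hv : (M.evolve e)^[n] x v = tape s t) :
    ∀ i ≤ n, ∃ u, x (v + i • dir e s) = tape s u := by
  induction n generalizing x with
  | zero =>
    intro i hi
    obtain rfl : i = 0 := by omega
    exact ⟨t, by simpa using hv⟩
  | succ n ih =>
    rw [Function.iterate_succ_apply] at hv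
    have h1 := ih (heads_evolve_eq_empty h) hv
    intro i hi
    cases i with
    | zero =>
      obtain ⟨u, hu⟩ := h1 0 n.zero_le
      exact ⟨u, (eq_tape_of_evolve_eq_tape h hu).1⟩
    | succ i =>
      obtain ⟨u, hu⟩ := h1 i (by omega)
      rw [succ_nsmul, ← add_assoc]
      exact (eq_tape_of_evolve_eq_tape h hu).2

theorem exists_iterate_eq_blank_of_heads_eq_empty (he : ¬ IsOfFinAddOrder e)
    {x : A → Cell Q Γ} (hx : {v | x v ≠ blank}.Finite) (h : heads x = ∅) :
    ∃ n, (M.evolve e)^[n] x = fun _ => blank := by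
  -- A surviving cell would give rise to more tape cells than there are nonblank cells.
  refine ⟨{v | x v ≠ blank}.ncard, funext fun v => ?_⟩
  have h0 : ∀ n, heads ((M.evolve e)^[n] x) = ∅ := fun n => by
    induction n with
    | zero => exact h
    | succ n ih => rw [Function.iterate_succ_apply']; exact heads_evolve_eq_empty ih
  cases hc : (M.evolve e)^[{v | x v ≠ blank}.ncard] x v with
  | blank => rfl
  | head d q t =>
    have : v ∈ heads ((M.evolve e)^[{v | x v ≠ blank}.ncard] x) := by simp [heads, hc]
    simp [h0] at this
  | tape s t =>
    exfalso
    have h1 := forall_eq_tape_of_iterate h hc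
    set N := {v | x v ≠ blank}.ncard
    have hsub : (fun i : ℕ => v + i • dir e s) '' ↑(Finset.range (N + 1)) ⊆ {v | x v ≠ blank} := by
      rintro _ ⟨i, hi, rfl⟩
      obtain ⟨u, hu⟩ := h1 i (by simpa [Nat.lt_succ_iff] using hi)
      simp [hu]
    have hinj : Function.Injective fun i : ℕ => v + i • dir e s := fun i j hij =>
      injective_nsmul_dir he s (add_left_cancel hij)
    have := Set.ncard_le_ncard hsub hx
    rw [Set.ncard_image_of_injective _ hinj, Set.ncard_coe_finset, Finset.card_range] at this
    omega

/-- If the sweeping automaton halts from every configuration, then every finite configuration of the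
cellular automaton dies out. -/
theorem exists_iterate_eq_blank (he : ¬ IsOfFinAddOrder e) (hM : ∀ c, Halts M.step c)
    {x : A → Cell Q Γ} (hx : {v | x v ≠ blank}.Finite) :
    ∃ n, (M.evolve e)^[n] x = fun _ => blank := by
  obtain ⟨n, hn⟩ := exists_heads_eq_empty he hM hx
  obtain ⟨m, hm⟩ :=
    exists_iterate_eq_blank_of_heads_eq_empty (M := M) he (finite_iterate_evolve hx n) hn
  exact ⟨m + n, by rwa [Function.iterate_add_apply]⟩

/-- A lonely word on which the sweeping automaton does not halt lives forever. -/
theorem iterate_ne_blank {x : A → Cell Q Γ} {v : A} {d : Bool} {c : SweepCfg Q Γ}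
    (hr : Rep e (EndsBlank e) x v d c) (hc : ¬ Halts M.step c) (n : ℕ) :
    (M.evolve e)^[n] x ≠ fun _ => blank := by
  induction n generalizing x v d c with
  | zero =>
    intro h
    have := hr.1
    simp_all
  | succ n ih =>
    obtain ⟨c', hc', hn⟩ : ∃ c', M.step c = some c' ∧ ¬ Halts M.step c' := by
      by_contra! h
      exact hc ⟨c, h⟩
    obtain ⟨c'', hc'', d', hr'⟩ := hr.evolve endCondition_endsBlank (hr.isHead_target hc')
    rw [hc'] at hc''
    cases hc''
    rw [Function.iterate_succ_apply]
    exact ih hr' hn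

end Sweeper

/-! ### Counter machines as sweeping automata -/

/-- `Leads f c c'`: the process driven by the partial map `f` gets from `c` to `c'`. -/
abbrev Leads {σ : Type} (f : σ → Option σ) : σ → σ → Prop :=
  Relation.ReflTransGen fun c c' => f c = some c'

/-- `LeadsPos f c c'`: the process driven by the partial map `f` gets from `c` to `c'` in at least
one step. -/
abbrev LeadsPos {σ : Type} (f : σ → Option σ) : σ → σ → Prop :=
  Relation.TransGen fun c c' => f c = some c'

theorem Halts.of_leads {σ : Type} {f : σ → Option σ} {c c' : σ} (h : Leads f c c')
    (hc : Halts f c') : Halts f c := by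
  induction h using Relation.ReflTransGen.head_induction_on with
  | refl => exact hc
  | head h _ ih => exact ⟨_, fun c'' h' => by rw [h] at h'; cases h'; exact ih⟩

theorem Halts.leads {σ : Type} {f : σ → Option σ} {c c' : σ} (h : Leads f c c')
    (hc : Halts f c) : Halts f c' := by
  induction h with
  | refl => exact hc
  | tail _ h ih => exact ih.inv h

/-- An instruction of a counter machine: `(i, n, none)` increments register `i` and jumps to `n`;
`(i, n, some m)` decrements register `i` and jumps to `n` if that register is positive, and jumps to
`m` otherwise. -/
abbrev Instr : Type := ℕ × ℕ × Option ℕ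

/-- A counter program; the entry `none`, as well as every place beyond the end, halts. -/
abbrev Program : Type := List (Option Instr)

namespace Program

/-- The instruction at place `n`. -/
def fetch (P : Program) (n : ℕ) : Option Instr := P.getD n none

/-- One step of a counter program. -/
def step (P : Program) (c : ℕ × (ℕ → ℕ)) : Option (ℕ × (ℕ → ℕ)) :=
  match P.fetch c.1 with
  | none => none
  | some (i, n, none) => some (n, Function.update c.2 i (c.2 i + 1))
  | some (i, n, some m) =>
    if c.2 i = 0 then some (m, c.2) else some (n, Function.update c.2 i (c.2 i - 1))

/-- The sweeping automaton that runs a counter program. The value of register `i` is the number of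
letters `i + 1`; the letter `0` is a filler. A state `(true, n)` executes the instruction at `n`
during the present sweep; a state `(false, n)` has done its work and begins with the instruction at
`n` after the next turn. -/
def sweeper (P : Program) : Sweeper (Bool × ℕ) ℕ where
  pass q t :=
    match P.fetch q.2 with
    | some (i, n, some _) => if q.1 = true ∧ t = i + 1 then ((false, n), 0) else (q, t)
    | _ => (q, t)
  turn q :=
    if q.1 = true then
      match P.fetch q.2 with
      | none => none
      | some (i, n, none) => some ((true, n), some (i + 1))
      | some (_, _, some m) => some ((true, m), none)
    else some ((true, q.2), none)

/-- The register contents represented by a word. -/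
def contents (w : List ℕ) (i : ℕ) : ℕ := w.count (i + 1)

theorem contents_perm {w w' : List ℕ} (h : w.Perm w') : contents w = contents w' :=
  funext fun _ => h.count_eq _

theorem contents_cons_succ (w : List ℕ) (i : ℕ) :
    contents ((i + 1) :: w) = Function.update (contents w) i (contents w i + 1) := by
  funext j
  by_cases h : j = i
  · subst h; simp [contents]
  · simp [contents, h, Ne.symm h]

theorem contents_cons_zero (w : List ℕ) : contents (0 :: w) = contents w := by
  funext j; simp [contents]

variable (P : Program)

/-- An idle head sweeps to the end and turns. -/
theorem sweep_idle (n t : ℕ) (as bs : List ℕ) :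
    ∃ t' as', LeadsPos P.sweeper.step ((false, n), t, as, bs) ((true, n), t', as', []) ∧
      (t' :: as').Perm (t :: as ++ bs) := by
  have hp : ∀ t, P.sweeper.pass (false, n) t = ((false, n), t) := fun t => by
    simp only [sweeper]; split <;> simp
  induction as generalizing t bs with
  | nil =>
    refine ⟨t, bs, .single ?_, by simp⟩
    simp only [Sweeper.step, hp]
    simp [sweeper]
  | cons u as ih =>
    obtain ⟨t', as', h, hw⟩ := ih u (t :: bs)
    refine ⟨t', as', .head ?_ h, hw.trans ?_⟩
    · simp [Sweeper.step, hp]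
    · simpa using List.perm_middle (a := t) (l₁ := u :: as) (l₂ := bs)

/-- A head that leaves all letters unchanged gets to the end of the word. -/
theorem sweep_through (q : Bool × ℕ) (t : ℕ) (as bs : List ℕ)
    (hp : ∀ u ∈ t :: as, P.sweeper.pass q u = (q, u)) :
    ∃ l bs', Leads P.sweeper.step (q, t, as, bs) (q, l, [], bs') ∧ P.sweeper.pass q l = (q, l) ∧
      (l :: bs').Perm (t :: as ++ bs) := by
  induction as generalizing t bs with
  | nil => exact ⟨t, bs, .refl, hp t (by simp), by simp⟩
  | cons u as ih =>
    obtain ⟨l, bs', h, hl, hw⟩ := ih u (t :: bs) fun v hv => hp v (List.mem_cons_of_mem _ hv)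
    refine ⟨l, bs', .head ?_ h, hl, hw.trans ?_⟩
    · simp [Sweeper.step, hp t (by simp)]
    · simpa using List.perm_middle (a := t) (l₁ := u :: as) (l₂ := bs)

/-- A decrementing head that finds the letter it is looking for replaces it with the filler. -/
theorem sweep_dec {n i n' m : ℕ} (hf : P.fetch n = some (i, n', some m)) (t : ℕ)
    (as bs : List ℕ) (hi : i + 1 ∈ t :: as) :
    ∃ t' as' w, LeadsPos P.sweeper.step ((true, n), t, as, bs) ((true, n'), t', as', []) ∧
      (t' :: as').Perm (0 :: w) ∧ ((i + 1) :: w).Perm (t :: as ++ bs) := by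
  induction as generalizing t bs with
  | nil =>
    obtain rfl : i + 1 = t := by simpa using hi
    refine ⟨0, bs, bs, .single ?_, .refl _, by simp⟩
    simp [Sweeper.step, sweeper, hf]
  | cons u as ih =>
    by_cases ht : t = i + 1
    · subst ht
      obtain ⟨t', as', h, hw⟩ := sweep_idle P n' u as (0 :: bs)
      refine ⟨t', as', u :: as ++ bs, .head ?_ h, hw.trans ?_, by simp⟩
      · simp [Sweeper.step, sweeper, hf]
      · simpa using List.perm_middle (a := 0) (l₁ := u :: as) (l₂ := bs)
    · obtain ⟨t', as', w, h, hw, hw'⟩ := ih u (t :: bs) (by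
        rcases List.mem_cons.1 hi with h | h
        · exact absurd h.symm ht
        · exact h)
      refine ⟨t', as', w, .head ?_ h, hw, hw'.trans ?_⟩
      · simp [Sweeper.step, sweeper, hf, ht]
      · simpa using List.perm_middle (a := t) (l₁ := u :: as) (l₂ := bs)

/-- The sweep of an active head halts or leads to the beginning of another sweep; a full sweep
carries out a step of the counter program. -/
theorem sweep_active (n t : ℕ) (as bs : List ℕ) :
    Halts P.sweeper.step ((true, n), t, as, bs) ∧ P.fetch n = none ∨
      ∃ n' t' as', LeadsPos P.sweeper.step ((true, n), t, as, bs) ((true, n'), t', as', []) ∧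
        (bs = [] → P.step (n, contents (t :: as)) = some (n', contents (t' :: as'))) := by
  rcases hf : P.fetch n with _ | ⟨i, n', _ | m⟩
  · refine .inl ⟨?_, rfl⟩
    obtain ⟨l, bs', h, hl, -⟩ := sweep_through P (true, n) t as bs fun u _ => by
      simp [sweeper, hf]
    refine .of_leads h ⟨_, fun c hc => ?_⟩
    simp only [Sweeper.step, hl] at hc
    simp [sweeper, hf] at hc
  · right
    obtain ⟨l, bs', h, hl, hw⟩ := sweep_through P (true, n) t as bs fun u _ => by
      simp [sweeper, hf]
    refine ⟨n', i + 1, l :: bs', .tail' h ?_, ?_⟩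
    · simp only [Sweeper.step, hl]
      simp [sweeper, hf]
    · rintro rfl
      rw [List.append_nil] at hw
      simp [step, hf, contents_cons_succ, contents_perm hw]
  · right
    by_cases hi : i + 1 ∈ t :: as
    · obtain ⟨t', as', w, h, hw, hw'⟩ := sweep_dec P hf t as bs hi
      refine ⟨n', t', as', h, ?_⟩
      rintro rfl
      rw [List.append_nil] at hw'
      simp [step, hf, contents_perm hw, ← contents_perm hw', contents_cons_succ,
        contents_cons_zero]
    · obtain ⟨l, bs', h, hl, hw⟩ := sweep_through P (true, n) t as bs fun u hu => by
        have : u ≠ i + 1 := fun h => hi (h ▸ hu)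
        simp [sweeper, hf, this]
      refine ⟨m, l, bs', .tail' h ?_, ?_⟩
      · simp only [Sweeper.step, hl]
        simp [sweeper, hf]
      · rintro rfl
        rw [List.append_nil] at hw
        have : contents (t :: as) i = 0 := List.count_eq_zero.2 hi
        simp [step, hf, this, contents_perm hw]

variable {P}

theorem halts_sweeper_of_forall_halts (h : ∀ c, Halts P.step c) (c : SweepCfg (Bool × ℕ) ℕ) :
    Halts P.sweeper.step c := by
  have key : ∀ c, Halts P.step c → ∀ t as, c.2 = contents (t :: as) →
      Halts P.sweeper.step ((true, c.1), t, as, []) := by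
    intro c hc
    induction hc with
    | intro c _ ih =>
      obtain ⟨n, r⟩ := c
      rintro t as rfl
      rcases sweep_active P n t as [] with ⟨h, -⟩ | ⟨n', t', as', h, hs⟩
      · exact h
      · exact .of_leads h.to_reflTransGen (ih _ (hs rfl) t' as' rfl)
  obtain ⟨⟨b, n⟩, t, as, bs⟩ := c
  cases b with
  | true =>
    rcases sweep_active P n t as bs with ⟨h, -⟩ | ⟨n', t', as', hl, -⟩
    · exact h
    · exact .of_leads hl.to_reflTransGen (key (n', _) (h _) t' as' rfl)
  | false =>
    obtain ⟨t', as', hl, -⟩ := sweep_idle P n t as bs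
    exact .of_leads hl.to_reflTransGen (key (n, _) (h _) t' as' rfl)

theorem halts_of_halts_sweeper {n t : ℕ} {as : List ℕ}
    (h : Halts P.sweeper.step ((true, n), t, as, [])) : Halts P.step (n, contents (t :: as)) := by
  have h' := Acc.transGen h
  generalize hc : (((true, n), t, as, []) : SweepCfg (Bool × ℕ) ℕ) = c at h'
  clear h
  induction h' generalizing n t as with
  | intro c _ ih =>
    subst hc
    refine ⟨_, fun c' hc' => ?_⟩
    rcases sweep_active P n t as [] with ⟨-, hf⟩ | ⟨n', t', as', hl, hs⟩
    · simp [step, hf] at hc'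
    · rw [hs rfl] at hc'
      cases hc'
      exact ih _ (Relation.transGen_swap.1 hl) rfl

end Program

/-! ### Loop programs -/

/-- Loop programs: `clear i` sets register `i` to zero, and `loop i p` means
"while register `i` is positive, decrement it and do `p`". -/
inductive LoopProg : Type
  | inc (i : ℕ)
  | clear (i : ℕ)
  | seq (p q : LoopProg)
  | loop (i : ℕ) (p : LoopProg)

namespace LoopProg

open Function

/-- The effect of a loop program on the registers. The number of rounds of a loop is fixed at its
beginning, which is right for programs that satisfy `WF`. -/
def eval : LoopProg → (ℕ → ℕ) → (ℕ → ℕ)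
  | inc i, r => update r i (r i + 1)
  | clear i, r => update r i 0
  | seq p q, r => eval q (eval p r)
  | loop i p, r => (fun s => eval p (update s i (s i - 1)))^[r i] r

/-- The body of each loop leaves the loop counter unchanged. -/
def WF : LoopProg → Prop
  | inc _ => True
  | clear _ => True
  | seq p q => WF p ∧ WF q
  | loop i p => WF p ∧ ∀ r, eval p r i = r i

/-- The number of instructions of the compiled program. -/
def size : LoopProg → ℕ
  | inc _ => 1
  | clear _ => 1
  | seq p q => size p + size q
  | loop _ p => size p + 1

/-- The instructions for a loop program that occupies the places from `b` on and exits to `e`. -/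
def compile : LoopProg → ℕ → ℕ → Program
  | inc i, _, e => [some (i, e, none)]
  | clear i, b, e => [some (i, b, some e)]
  | seq p q, b, e => compile p b (b + size p) ++ compile q (b + size p) e
  | loop i p, b, e => some (i, b + 1, some e) :: compile p (b + 1) b

theorem length_compile (p : LoopProg) (b e : ℕ) : (p.compile b e).length = p.size := by
  induction p generalizing b e <;> simp [compile, size, *]

theorem size_pos (p : LoopProg) : 0 < p.size := by
  induction p <;> simp [size, *]

/-- The program `P` contains the instructions `L` from place `b` on. -/
def _root_.Program.Contains (P : Program) (b : ℕ) (L : Program) : Prop :=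
  ∀ (k : ℕ) (I : Option Instr), L[k]? = some I → P.fetch (b + k) = I

theorem _root_.Program.Contains.left {P : Program} {b : ℕ} {L L' : Program}
    (h : P.Contains b (L ++ L')) : P.Contains b L := fun k I hk =>
  h k I (by rw [List.getElem?_append_left (List.getElem?_eq_some_iff.1 hk).1, hk])

theorem _root_.Program.Contains.right {P : Program} {b : ℕ} {L L' : Program}
    (h : P.Contains b (L ++ L')) : P.Contains (b + L.length) L' := fun k I hk => by
  rw [add_assoc]
  exact h _ I (by rw [List.getElem?_append_right (by omega)]; simpa using hk)

theorem _root_.Program.Contains.head {P : Program} {b : ℕ} {I : Option Instr} {L : Program}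
    (h : P.Contains b (I :: L)) : P.fetch b = I := h 0 I rfl

theorem _root_.Program.Contains.tail {P : Program} {b : ℕ} {I : Option Instr} {L : Program}
    (h : P.Contains b (I :: L)) : P.Contains (b + 1) L := fun k J hk => by
  rw [add_assoc, add_comm 1]; exact h _ J hk

theorem leads_inc {P : Program} {n i n' : ℕ} (h : P.fetch n = some (i, n', none)) (r : ℕ → ℕ) :
    Leads P.step (n, r) (n', update r i (r i + 1)) :=
  .single (by simp [Program.step, h])

theorem leads_dec_zero {P : Program} {n i n' m : ℕ} (h : P.fetch n = some (i, n', some m))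
    {r : ℕ → ℕ} (hr : r i = 0) : Leads P.step (n, r) (m, r) :=
  .single (by simp [Program.step, h, hr])

theorem leads_dec_pos {P : Program} {n i n' m : ℕ} (h : P.fetch n = some (i, n', some m))
    {r : ℕ → ℕ} (hr : r i ≠ 0) : Leads P.step (n, r) (n', update r i (r i - 1)) :=
  .single (by simp [Program.step, h, hr])

theorem leads_clear {P : Program} {n i m : ℕ} (h : P.fetch n = some (i, n, some m))
    (r : ℕ → ℕ) : Leads P.step (n, r) (m, update r i 0) := by
  induction hk : r i generalizing r with
  | zero => simpa [← hk] using leads_dec_zero h hk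
  | succ k ih =>
    have h1 := leads_dec_pos h (r := r) (by omega)
    have h2 := ih (update r i (r i - 1)) (by simp [hk])
    rw [update_idem] at h2
    exact h1.trans h2

/-- The compiled program does what the loop program does. -/
theorem leads_eval {P : Program} {p : LoopProg} (hp : p.WF) {b e : ℕ}
    (h : P.Contains b (p.compile b e)) (r : ℕ → ℕ) : Leads P.step (b, r) (e, p.eval r) := by
  induction p generalizing b e r with
  | inc i => exact leads_inc h.head r
  | clear i => exact leads_clear h.head r
  | seq p q ihp ihq =>
    have h2 := h.right
    rw [length_compile] at h2
    exact (ihp hp.1 h.left r).trans (ihq hp.2 h2 _)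
  | loop i p ih =>
    induction hk : r i generalizing r with
    | zero => simpa [eval, hk] using leads_dec_zero h.head hk
    | succ k ihk =>
      have h1 := leads_dec_pos h.head (r := r) (by omega)
      have h2 := ih hp.1 h.tail (update r i (r i - 1))
      have h3 : eval p (update r i (r i - 1)) i = k := by rw [hp.2]; simp [hk]
      have h4 := ihk _ h3
      have h5 : eval (loop i p) r = eval (loop i p) (eval p (update r i (r i - 1))) := by
        rw [hk] at h3
        simp only [eval, hk, h3, iterate_succ_apply]
      rw [h5]
      exact (h1.trans h2).trans h4

/-- From any place inside a compiled program and with any register contents, the exit is reached. -/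
theorem exists_leads_exit {P : Program} {p : LoopProg} (hp : p.WF) {b e : ℕ}
    (h : P.Contains b (p.compile b e)) {n : ℕ} (hb : b ≤ n) (hn : n < b + p.size) (r : ℕ → ℕ) :
    ∃ r', Leads P.step (n, r) (e, r') := by
  induction p generalizing b e n r with
  | inc i =>
    obtain rfl : n = b := by simp only [size] at hn; omega
    exact ⟨_, leads_eval hp h r⟩
  | clear i =>
    obtain rfl : n = b := by simp only [size] at hn; omega
    exact ⟨_, leads_eval hp h r⟩
  | seq p q ihp ihq =>
    have h2 := h.right
    rw [length_compile] at h2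
    simp only [size] at hn
    rcases Nat.lt_or_ge n (b + p.size) with hlt | hge
    · obtain ⟨r', hr'⟩ := ihp hp.1 h.left hb hlt r
      exact ⟨_, hr'.trans (leads_eval hp.2 h2 r')⟩
    · exact ihq hp.2 h2 hge (by omega) r
  | loop i p ih =>
    simp only [size] at hn
    rcases Nat.eq_or_lt_of_le hb with rfl | hlt
    · exact ⟨_, leads_eval hp h r⟩
    · obtain ⟨r', hr'⟩ := ih hp.1 h.tail hlt (by omega) r
      exact ⟨_, hr'.trans (leads_eval hp h r')⟩

/-! ### Loop programs compute the primitive recursive functions -/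

/-- The program `p` computes `f` on the registers `ins`, puts the result into register `o` and
changes no other register below `b`. -/
structure Computes {n : ℕ} (p : LoopProg) (f : List.Vector ℕ n → ℕ) (ins : Fin n → ℕ) (o b : ℕ) :
    Prop where
  wf : p.WF
  eval_out : ∀ r, p.eval r o = f (List.Vector.ofFn fun i => r (ins i))
  eval_of_lt : ∀ r j, j < b → j ≠ o → p.eval r j = r j

theorem eval_loop_of_eq {i : ℕ} {p : LoopProg} {r : ℕ → ℕ} (F : ℕ → ℕ → ℕ) (h0 : F 0 = r)
    (hF : ∀ k < r i, p.eval (update (F k) i (F k i - 1)) = F (k + 1)) :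
    (loop i p).eval r = F (r i) := by
  have : ∀ k ≤ r i, (fun s => eval p (update s i (s i - 1)))^[k] r = F k := by
    intro k
    induction k with
    | zero => intro _; simp [h0]
    | succ k ih =>
      intro hk
      rw [iterate_succ_apply', ih (by omega)]
      exact hF k (by omega)
  exact this _ le_rfl

/-- Copies register `x` to register `o` by way of register `t`. -/
def copy (x o t : ℕ) : LoopProg :=
  seq (seq (clear o) (clear t)) (seq (loop x (inc t)) (loop t (seq (inc x) (inc o))))

theorem wf_copy {x o t : ℕ} (hxt : x ≠ t) (hto : t ≠ o) : (copy x o t).WF := by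
  simp [copy, WF, eval, hxt, hxt.symm, hto]

theorem eval_copy {x o t : ℕ} (hxo : x ≠ o) (hxt : x ≠ t) (hto : t ≠ o) (r : ℕ → ℕ) :
    (copy x o t).eval r = update (update r o (r x)) t 0 := by
  have h1 : ∀ r : ℕ → ℕ, (loop x (inc t)).eval r = update (update r x 0) t (r t + r x) := by
    intro r
    rw [eval_loop_of_eq fun k => update (update r x (r x - k)) t (r t + k)]
    · simp
    · simp
    · intro k hk
      funext j
      simp only [eval, update_apply]
      split_ifs <;> omega
  have h2 : ∀ r : ℕ → ℕ, (loop t (seq (inc x) (inc o))).eval r =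
      update (update (update r t 0) x (r x + r t)) o (r o + r t) := by
    intro r
    rw [eval_loop_of_eq fun k => update (update (update r t (r t - k)) x (r x + k)) o (r o + k)]
    · simp
    · simp
    · intro k hk
      funext j
      simp only [eval, update_apply]
      split_ifs <;> omega
  have h3 : (copy x o t).eval r = (loop t (seq (inc x) (inc o))).eval
      ((loop x (inc t)).eval (update (update r o 0) t 0)) := rfl
  rw [h3, h1, h2]
  clear h1 h2 h3
  funext j
  simp only [update_apply]
  grind

/-- Auxiliary to composition: a list of functions is computed into consecutive registers. -/
theorem exists_computes_all {m : ℕ} (ins : Fin m → ℕ) (b : ℕ) (hins : ∀ i, ins i < b) (n : ℕ)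
    (g : Fin n → List.Vector ℕ m → ℕ)
    (hg : ∀ i o b, (∀ i, ins i < b) → o < b → (∀ i, ins i ≠ o) →
      ∃ p : LoopProg, p.Computes (g i) ins o b) :
    ∃ p : LoopProg, p.WF ∧
      (∀ r i, p.eval r (b + i.1) = g i (List.Vector.ofFn fun i => r (ins i))) ∧
      ∀ r j, j < b → p.eval r j = r j := by
  induction n with
  | zero => exact ⟨clear b, trivial, fun _ i => i.elim0, fun r j hj => by simp [eval, hj.ne]⟩
  | succ n ih =>
    obtain ⟨p, hp, hp1, hp2⟩ := ih (fun i => g i.castSucc) fun i => hg i.castSucc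
    obtain ⟨q, hq⟩ := hg (Fin.last n) (b + n) (b + n + 1)
      (fun i => (hins i).trans (by omega)) (by omega) fun i => by have := hins i; omega
    refine ⟨seq p q, ⟨hp, hq.wf⟩, fun r i => ?_, fun r j hj => ?_⟩
    · refine Fin.lastCases ?_ (fun i => ?_) i
      · simp only [eval, Fin.val_last, hq.eval_out]
        congr 2
        funext i
        exact hp2 r _ (hins i)
      · simp only [eval, Fin.val_castSucc]
        rw [hq.eval_of_lt _ _ (by omega) (by omega), hp1]
    · simp only [eval]
      rw [hq.eval_of_lt _ _ (by omega) (by omega), hp2 r j hj]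

theorem exists_computes {n : ℕ} {f : List.Vector ℕ n → ℕ} (hf : Nat.Primrec' f) :
    ∀ (ins : Fin n → ℕ) (o b : ℕ), (∀ i, ins i < b) → o < b → (∀ i, ins i ≠ o) →
      ∃ p : LoopProg, p.Computes f ins o b := by
  induction hf with
  | zero =>
    intro ins o b _ _ _
    exact ⟨clear o, trivial, fun r => by simp [eval], fun r j _ hj => by simp [eval, hj]⟩
  | succ =>
    intro ins o b hi ho hio
    have h1 : ins 0 ≠ b := (hi 0).ne
    refine ⟨seq (copy (ins 0) o b) (inc o), ⟨wf_copy h1 ho.ne', trivial⟩, fun r => ?_,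
      fun r j hj hjo => ?_⟩
    · simp [eval, eval_copy (hio 0) h1 ho.ne', ho.ne, List.Vector.ofFn]
    · simp [eval, eval_copy (hio 0) h1 ho.ne', hjo, hj.ne]
  | get i =>
    intro ins o b hi ho hio
    have h1 : ins i ≠ b := (hi i).ne
    refine ⟨copy (ins i) o b, wf_copy h1 ho.ne', fun r => ?_, fun r j hj hjo => ?_⟩
    · simp [eval_copy (hio i) h1 ho.ne', ho.ne]
    · simp [eval_copy (hio i) h1 ho.ne', hjo, hj.ne]
  | @comp m n f g _ _ ihf ihg =>
    intro ins o b hi ho hio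
    obtain ⟨p, hp, hp1, hp2⟩ := exists_computes_all ins b hi _ g fun i o b => ihg i ins o b
    obtain ⟨q, hq⟩ := ihf (fun i => b + i.1) o (b + n) (fun i => by omega) (by omega)
      fun i => by omega
    refine ⟨seq p q, ⟨hp, hq.wf⟩, fun r => ?_, fun r j hj hjo => ?_⟩
    · simp only [eval, hq.eval_out, hp1]
    · simp only [eval]
      rw [hq.eval_of_lt _ _ (by omega) hjo, hp2 r j hj]
  | @prec n f g _ _ ihf ihg =>
    intro ins o b hi ho hio
    -- The scratch registers hold: the remaining rounds, the present argument of the recursion, the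
    -- value there, the next value; the last one serves for copying.
    obtain ⟨c, y, v, w, t, hc, hy, hv, hw, ht⟩ :
        ∃ c y v w t, c = b ∧ y = b + 1 ∧ v = b + 2 ∧ w = b + 3 ∧ t = b + 4 :=
      ⟨_, _, _, _, _, rfl, rfl, rfl, rfl, rfl⟩
    obtain ⟨pf, hpf⟩ := ihf (fun i => ins i.succ) v (b + 5)
      (fun i => by have := hi i.succ; omega) (by omega) fun i => by have := hi i.succ; omega
    obtain ⟨pg, hpg⟩ := ihg (Fin.cons y (Fin.cons v fun i => ins i.succ)) w (b + 5)
      (fun i => by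
        refine Fin.cases (by simp; omega) (fun i => ?_) i
        refine Fin.cases (by simp; omega) (fun i => ?_) i
        have := hi i.succ
        simp only [Fin.cons_succ]; omega) (by omega)
      (fun i => by
        refine Fin.cases (by simp; omega) (fun i => ?_) i
        refine Fin.cases (by simp; omega) (fun i => ?_) i
        have := hi i.succ
        simp only [Fin.cons_succ]; omega)
    have hi0 := hi 0
    let body := seq pg (seq (copy w v t) (inc y))
    have hbody : ∀ r j, j ≠ y → j ≠ v → j ≠ w → j ≠ t → j < b + 5 → body.eval r j = r j := by
      intro r j h1 h2 h3 h4 h5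
      simp only [body, eval, eval_copy (show w ≠ v by omega) (show w ≠ t by omega)
        (show t ≠ v by omega), update_apply, h1, h2, h4, if_false]
      exact hpg.eval_of_lt _ _ h5 h3
    have hbody_y : ∀ r, body.eval r y = r y + 1 := by
      intro r
      simp only [body, eval, eval_copy (show w ≠ v by omega) (show w ≠ t by omega)
        (show t ≠ v by omega), update_apply, if_true, show y ≠ t by omega, show y ≠ v by omega,
        if_false]
      rw [hpg.eval_of_lt _ _ (by omega) (by omega)]
    have hbody_v : ∀ r, body.eval r v =
        g (r y ::ᵥ r v ::ᵥ List.Vector.ofFn fun i => r (ins i.succ)) := by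
      intro r
      simp only [body, eval, eval_copy (show w ≠ v by omega) (show w ≠ t by omega)
        (show t ≠ v by omega), update_apply, if_true, show v ≠ t by omega, show v ≠ y by omega,
        if_false]
      rw [hpg.eval_out]
      simp [List.Vector.ofFn]
    have hloop : ∀ k r, ((fun s => eval body (update s c (s c - 1)))^[k] r) y = r y + k ∧
        (∀ j < b, ((fun s => eval body (update s c (s c - 1)))^[k] r) j = r j) ∧
        (r y = 0 → ((fun s => eval body (update s c (s c - 1)))^[k] r) v =
          Nat.rec (r v) (fun y IH => g (y ::ᵥ IH ::ᵥ List.Vector.ofFn fun i => r (ins i.succ)))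
            k) := by
      intro k r
      induction k with
      | zero => simp
      | succ k ih =>
        obtain ⟨h1, h2, h3⟩ := ih
        rw [iterate_succ_apply']
        refine ⟨?_, fun j hj => ?_, fun h0 => ?_⟩
        · rw [hbody_y, update_of_ne (by omega), h1]; omega
        · rw [hbody _ _ (by omega) (by omega) (by omega) (by omega) (by omega),
            update_of_ne (by omega), h2 j hj]
        · rw [hbody_v, update_of_ne (by omega), update_of_ne (by omega), h1, h3 h0, h0, zero_add]
          have : (fun i : Fin n => update ((fun s => eval body (update s c (s c - 1)))^[k] r) c
              (((fun s => eval body (update s c (s c - 1)))^[k] r) c - 1) (ins i.succ)) =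
              fun i => r (ins i.succ) := by
            funext i
            have := hi i.succ
            rw [update_of_ne (by omega), h2 _ this]
          rw [this]
    refine ⟨seq (seq pf (clear y)) (seq (copy (ins 0) c t) (seq (loop c body) (copy v o t))),
      ⟨⟨hpf.wf, trivial⟩, wf_copy (by omega) (by omega),
        ⟨⟨hpg.wf, wf_copy (by omega) (by omega), trivial⟩,
          fun r => hbody r c (by omega) (by omega) (by omega) (by omega) (by omega)⟩,
        wf_copy (by omega) (by omega)⟩, fun r => ?_, fun r j hj hjo => ?_⟩
    · simp only [eval, eval_copy (show v ≠ o by omega) (show v ≠ t by omega)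
        (show t ≠ o by omega), update_of_ne (show o ≠ t by omega), update_self]
      rw [(hloop _ _).2.2 (by
        rw [eval_copy (by omega) (by omega) (by omega), update_of_ne (by omega),
          update_of_ne (by omega), update_self])]
      simp only [eval_copy (show ins 0 ≠ c by omega) (show ins 0 ≠ t by omega)
        (show t ≠ c by omega), update_of_ne (show c ≠ t by omega),
        update_self, update_of_ne (show v ≠ t by omega), update_of_ne (show v ≠ c by omega),
        update_of_ne (show v ≠ y by omega), update_of_ne (show ins 0 ≠ y by omega), hpf.eval_out,
        hpf.eval_of_lt r (ins 0) (by omega) (by omega)]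
      have : (fun i : Fin n => update (update (update (eval pf r) y 0) c (r (ins 0))) t 0
          (ins i.succ)) = fun i => r (ins i.succ) := by
        funext i
        have := hi i.succ
        rw [update_of_ne (by omega), update_of_ne (by omega), update_of_ne (by omega),
          hpf.eval_of_lt r _ (by omega) (by omega)]
      rw [this]
      simp [List.Vector.ofFn]
    · simp only [eval, eval_copy (show v ≠ o by omega) (show v ≠ t by omega)
        (show t ≠ o by omega), update_of_ne (show j ≠ t by omega), update_of_ne hjo]
      rw [(hloop _ _).2.1 j hj, eval_copy (by omega) (by omega) (by omega),
        update_of_ne (by omega), update_of_ne (by omega), update_of_ne (by omega),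
        hpf.eval_of_lt r j (by omega) (by omega)]

end LoopProg

/-! ### A counter program that halts from all configurations -/

namespace LoopProg

open Function

variable (body : LoopProg) (a : ℕ)

/-- The exit of `body` in `searchProgram body a`. -/
def exit : ℕ := 1 + body.size

/-- The program that puts `a` into register `0`, increments register `2` and executes `body`, again
and again until `body` leaves a positive number in register `3`. Place `0` halts, and `body` begins
at place `1`. -/
def searchProgram : Program :=
  (none :: body.compile 1 body.exit) ++
    ([some (3, 0, some (body.exit + 1)), some (0, body.exit + 1, some (body.exit + 2))] ++
      ((List.range a).map (fun j => some (0, body.exit + 3 + j, none)) ++ [some (2, 1, none)]))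

theorem contains_self (P : Program) : P.Contains 0 P := fun k I hk => by
  simp [Program.fetch, hk]

theorem contains_searchProgram :
    (body.searchProgram a).Contains 1 (body.compile 1 body.exit) :=
  (contains_self (body.searchProgram a)).left.tail

theorem contains_searchProgram_right : (body.searchProgram a).Contains body.exit
    ([some (3, 0, some (body.exit + 1)), some (0, body.exit + 1, some (body.exit + 2))] ++
      ((List.range a).map (fun j => some (0, body.exit + 3 + j, none)) ++
        [some (2, 1, none)])) := by
  have := (contains_self (body.searchProgram a)).right
  rwa [List.length_cons, length_compile, Nat.zero_add, Nat.add_comm] at this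

theorem fetch_exit :
    (body.searchProgram a).fetch body.exit = some (3, 0, some (body.exit + 1)) :=
  (contains_searchProgram_right body a).head

theorem fetch_exit_add_one : (body.searchProgram a).fetch (body.exit + 1) =
    some (0, body.exit + 1, some (body.exit + 2)) :=
  (contains_searchProgram_right body a).tail.head

theorem fetch_exit_add_two {k : ℕ} (hk : k < a) : (body.searchProgram a).fetch (body.exit + 2 + k) =
    some (0, body.exit + 3 + k, none) :=
  (contains_searchProgram_right body a).right.left k _ (by simp [hk])

theorem fetch_last :
    (body.searchProgram a).fetch (body.exit + 2 + a) = some (2, 1, none) := by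
  simpa using (contains_searchProgram_right body a).right.right.head

theorem fetch_of_lt {n : ℕ} (hn : body.exit + 2 + a < n) :
    (body.searchProgram a).fetch n = none := by
  rw [Program.fetch, List.getD_eq_getElem?_getD, List.getElem?_eq_none]
  · rfl
  · simp [searchProgram, length_compile, exit] at hn ⊢; omega

theorem halts_of_fetch_eq_none {P : Program} {n : ℕ} (h : P.fetch n = none) (r : ℕ → ℕ) :
    Halts P.step (n, r) :=
  ⟨_, fun c hc => by simp [Program.step, h] at hc⟩

theorem leads_increments (r : ℕ → ℕ) {j k : ℕ} (hk : j + k = a) :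
    Leads (body.searchProgram a).step (body.exit + 2 + j, r)
      (body.exit + 2 + a, update r 0 (r 0 + k)) := by
  induction k generalizing j r with
  | zero =>
    obtain rfl : j = a := hk
    simpa using Relation.ReflTransGen.refl
  | succ k ih =>
    have h1 := leads_inc (fetch_exit_add_two body a (k := j) (by omega)) r
    have h2 := ih (update r 0 (r 0 + 1)) (j := j + 1) (by omega)
    rw [show body.exit + 2 + (j + 1) = body.exit + 3 + j by omega] at h2
    have h3 := h1.trans h2
    simpa [add_assoc, add_comm 1 k] using h3

variable {body a} {f : List.Vector ℕ 3 → ℕ}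

/-- One round of the search, from the place where register `0` has just been cleared. -/
theorem leads_round (hb : body.Computes f (fun i => i.1) 3 4) {r : ℕ → ℕ} (h0 : r 0 = 0) :
    ∃ r', LeadsPos (body.searchProgram a).step (body.exit + 2, r) (body.exit, r') ∧
      r' 1 = r 1 ∧ r' 2 = r 2 + 1 ∧ r' 3 = f (a ::ᵥ r 1 ::ᵥ (r 2 + 1) ::ᵥ .nil) := by
  have h1 := leads_increments body a r (zero_add a)
  rw [h0, zero_add] at h1
  set s := update r 0 a
  have h2 : (body.searchProgram a).step (body.exit + 2 + a, s) =
      some (1, update s 2 (s 2 + 1)) := by simp [Program.step, fetch_last]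
  have h3 := leads_eval hb.wf (contains_searchProgram body a) (update s 2 (s 2 + 1))
  refine ⟨_, (Relation.TransGen.tail' h1 h2).trans_left h3, ?_, ?_, ?_⟩
  · rw [hb.eval_of_lt _ _ (by omega) (by omega)]; simp [s]
  · rw [hb.eval_of_lt _ _ (by omega) (by omega)]; simp [s]
  · rw [hb.eval_out]
    simp [List.Vector.ofFn, s]

theorem leads_next_round {r : ℕ → ℕ} (h3 : r 3 = 0) :
    Leads (body.searchProgram a).step (body.exit, r) (body.exit + 2, update r 0 0) :=
  (leads_dec_zero (fetch_exit body a) h3).trans (leads_clear (fetch_exit_add_one body a) r)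

theorem halts_exit_of_ne_zero {r : ℕ → ℕ} (h3 : r 3 ≠ 0) :
    Halts (body.searchProgram a).step (body.exit, r) :=
  .of_leads (leads_dec_pos (fetch_exit body a) h3) (halts_of_fetch_eq_none rfl _)

/-- If all searches are successful, the search program halts from every configuration, also from
those that do not occur in a computation. -/
theorem halts_searchProgram (hb : body.Computes f (fun i => i.1) 3 4)
    (hf : ∀ m, ∃ n₀, ∀ n ≥ n₀, f (a ::ᵥ m ::ᵥ n ::ᵥ .nil) ≠ 0) (c : ℕ × (ℕ → ℕ)) :
    Halts (body.searchProgram a).step c := by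
  have h2 : ∀ r : ℕ → ℕ, r 0 = 0 → Halts (body.searchProgram a).step (body.exit + 2, r) := by
    intro r
    obtain ⟨n₀, hn₀⟩ := hf (r 1)
    -- Each round without success increments register `2`, until it exceeds `n₀`.
    induction hk : n₀ - r 2 generalizing r with
    | zero =>
      intro h0
      obtain ⟨r', hl, -, -, h3⟩ := leads_round (a := a) hb h0
      refine .of_leads hl.to_reflTransGen (halts_exit_of_ne_zero ?_)
      rw [h3]
      exact hn₀ _ (by omega)
    | succ k ih =>
      intro h0
      obtain ⟨r', hl, h1', h2', -⟩ := leads_round (a := a) hb h0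
      refine .of_leads hl.to_reflTransGen ?_
      by_cases h3 : r' 3 = 0
      · refine .of_leads (leads_next_round h3) (ih _ ?_ ?_ (by simp))
        · simpa [h1'] using hn₀
        · simp [h2']; omega
      · exact halts_exit_of_ne_zero h3
  -- A test of leftover data may halt at once; otherwise it leads to a proper round.
  have h1 : ∀ r : ℕ → ℕ, Halts (body.searchProgram a).step (body.exit, r) := by
    intro r
    by_cases h3 : r 3 = 0
    · exact .of_leads (leads_next_round h3) (h2 _ (by simp))
    · exact halts_exit_of_ne_zero h3
  obtain ⟨n, r⟩ := c
  rcases Nat.eq_zero_or_pos n with rfl | hpos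
  · exact halts_of_fetch_eq_none rfl r
  have hin : ∀ n, 1 ≤ n → n < body.exit → ∀ r, Halts (body.searchProgram a).step (n, r) := by
    intro n hn hn' r
    obtain ⟨r', hr'⟩ := exists_leads_exit hb.wf (contains_searchProgram body a) hn hn' r
    exact .of_leads hr' (h1 r')
  rcases Nat.lt_or_ge n body.exit with hlt | hge
  · exact hin n hpos hlt r
  rcases Nat.lt_or_ge n (body.exit + 2) with hlt | hge'
  · obtain rfl | rfl : n = body.exit ∨ n = body.exit + 1 := by omega
    · exact h1 r
    · exact .of_leads (leads_clear (fetch_exit_add_one body a) r) (h2 _ (by simp))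
  rcases Nat.lt_or_ge (body.exit + 2 + a) n with hlt | hge''
  · exact halts_of_fetch_eq_none (fetch_of_lt body a hlt) r
  · obtain ⟨j, rfl⟩ := Nat.exists_eq_add_of_le hge'
    obtain ⟨k, hk⟩ := Nat.exists_eq_add_of_le (show j ≤ a by omega)
    refine .of_leads (leads_increments body a r hk.symm)
      (.of_leads (leads_inc (fetch_last body a) _) (hin 1 le_rfl ?_ _))
    have := body.size_pos
    simp only [exit]; omega

/-- A search without success does not halt. -/
theorem not_halts_searchProgram (hb : body.Computes f (fun i => i.1) 3 4) {r : ℕ → ℕ}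
    (h0 : r 0 = 0) (hf : ∀ n, f (a ::ᵥ r 1 ::ᵥ n ::ᵥ .nil) = 0) :
    ¬ Halts (body.searchProgram a).step (body.exit + 2, r) := by
  intro h
  have h' := Acc.transGen h
  generalize hc : (body.exit + 2, r) = c at h'
  clear h
  induction h' generalizing r with
  | intro c _ ih =>
    subst hc
    obtain ⟨r', hl, h1', h2', h3⟩ := leads_round (a := a) hb h0
    rw [hf] at h3
    refine ih _ (Relation.transGen_swap.1 (hl.trans_left (leads_next_round h3))) (by simp) ?_ rfl
    simpa [h1'] using hf

theorem primrec_searchProgram (body : LoopProg) : Primrec body.searchProgram := by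
  refine Primrec.list_append.comp (.const _) (Primrec.list_append.comp (.const _)
    (Primrec.list_append.comp (Primrec.list_map Primrec.list_range ?_) (.const _)))
  exact Primrec.option_some.comp ((Primrec.const 0).pair
    ((Primrec.nat_add.comp (.const _) .snd).pair (.const none)))

end LoopProg

/-! ### Descriptions of the cellular automata -/

namespace Cell

variable {Q Γ : Type}

/-- Cells as the elements of a sum type. -/
def equivSum : Cell Q Γ ≃ Option ((Bool × Γ) ⊕ (Bool × Q × Γ)) where
  toFun
    | blank => none
    | tape s t => some (.inl (s, t))
    | head d q t => some (.inr (d, q, t))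
  invFun
    | none => blank
    | some (.inl (s, t)) => tape s t
    | some (.inr (d, q, t)) => head d q t
  left_inv c := by cases c <;> rfl
  right_inv c := by rcases c with _ | ⟨_ | _⟩ <;> rfl

variable [Primcodable Q] [Primcodable Γ]

instance : Primcodable (Cell Q Γ) := Primcodable.ofEquiv _ equivSum

theorem primrec_tape : Primrec₂ (tape : Bool → Γ → Cell Q Γ) :=
  (Primrec.of_equiv_symm (e := equivSum)).comp
    (Primrec.option_some.comp (Primrec.sumInl.comp .id))

theorem primrec_head : Primrec fun p : Bool × Q × Γ => head p.1 p.2.1 p.2.2 :=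
  (Primrec.of_equiv_symm (e := equivSum)).comp
    (Primrec.option_some.comp (Primrec.sumInr.comp .id))

theorem primrec_casesOn {α σ : Type} [Primcodable α] [Primcodable σ] {f : α → Cell Q Γ}
    {g : α → σ} {h : α → Bool × Γ → σ} {k : α → Bool × Q × Γ → σ} (hf : Primrec f)
    (hg : Primrec g) (hh : Primrec₂ h) (hk : Primrec₂ k) :
    Primrec fun a => match f a with
      | blank => g a
      | tape s t => h a (s, t)
      | head d q t => k a (d, q, t) := by
  refine (Primrec.option_casesOn ((Primrec.of_equiv (e := equivSum)).comp hf) hg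
    (Primrec.sumCasesOn .snd (hh.comp (Primrec.fst.comp .fst) .snd).to₂
      (hk.comp (Primrec.fst.comp .fst) .snd).to₂).to₂).of_eq fun a => ?_
  cases f a <;> rfl

end Cell

namespace Program

open Cell

theorem primrec_fetch : Primrec₂ fetch := Primrec.list_getD none

theorem primrec_pass :
    Primrec fun p : Program × (Bool × ℕ) × ℕ => p.1.sweeper.pass p.2.1 p.2.2 := by
  have h : Primrec fun p : Program × (Bool × ℕ) × ℕ => (p.2.1, p.2.2) := .snd
  refine (Primrec.option_casesOn
    (primrec_fetch.comp .fst (Primrec.snd.comp (Primrec.fst.comp .snd)))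
    h (Primrec.option_casesOn (Primrec.snd.comp (Primrec.snd.comp .snd)) (h.comp .fst)
      (Primrec.ite (PrimrecPred.and
        (Primrec.eq.comp (Primrec.fst.comp (Primrec.fst.comp (Primrec.snd.comp
          (Primrec.fst.comp .fst)))) (.const true))
        (Primrec.eq.comp (Primrec.snd.comp (Primrec.snd.comp (Primrec.fst.comp .fst)))
          (Primrec.succ.comp (Primrec.fst.comp (Primrec.snd.comp .fst)))))
        (((Primrec.const false).pair
          (Primrec.fst.comp (Primrec.snd.comp (Primrec.snd.comp .fst)))).pair (.const 0))
        (h.comp (Primrec.fst.comp .fst))).to₂).to₂).of_eq ?_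
  rintro ⟨P, ⟨b, n⟩, t⟩
  simp only [sweeper]
  rcases P.fetch n with _ | ⟨i, n', _ | m⟩ <;> rfl

theorem primrec_turn : Primrec fun p : Program × (Bool × ℕ) => p.1.sweeper.turn p.2 := by
  refine (Primrec.ite (Primrec.eq.comp (Primrec.fst.comp .snd) (.const true))
    (Primrec.option_casesOn (primrec_fetch.comp .fst (Primrec.snd.comp .snd)) (.const none)
      (Primrec.option_some.comp (Primrec.option_casesOn (Primrec.snd.comp (Primrec.snd.comp .snd))
        (((Primrec.const true).pair (Primrec.fst.comp (Primrec.snd.comp .snd))).pair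
          (Primrec.option_some.comp (Primrec.succ.comp (Primrec.fst.comp .snd))))
        (((Primrec.const true).pair .snd).pair (.const none)).to₂)).to₂)
    (Primrec.option_some.comp
      (((Primrec.const true).pair (Primrec.snd.comp .snd)).pair (.const none)))).of_eq ?_
  rintro ⟨P, b, n⟩
  simp only [sweeper]
  rcases P.fetch n with _ | ⟨i, n', _ | m⟩ <;> rfl

theorem primrec_grow : Primrec fun p : Program × Bool × Cell (Bool × ℕ) ℕ =>
    p.1.sweeper.grow p.2.1 p.2.2 := by
  refine (primrec_casesOn (Primrec.snd.comp .snd) (.const none) (Primrec.const none).to₂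
    (Primrec.ite (Primrec.eq.comp (Primrec.fst.comp .snd)
        (Primrec.fst.comp (Primrec.snd.comp .fst)))
      (Primrec.option_bind (primrec_turn.comp ((Primrec.fst.comp .fst).pair
          (Primrec.fst.comp (primrec_pass.comp ((Primrec.fst.comp .fst).pair
            (Primrec.snd.comp .snd))))))
        (Primrec.option_map (Primrec.snd.comp .snd)
          (primrec_head.comp ((Primrec.not.comp (Primrec.fst.comp (Primrec.snd.comp
            (Primrec.fst.comp (Primrec.fst.comp .fst))))).pair
            ((Primrec.fst.comp (Primrec.snd.comp .fst)).pair .snd))).to₂).to₂)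
      (.const none)).to₂).of_eq ?_
  rintro ⟨P, d, c⟩
  rcases c with _ | _ | ⟨d', q, t⟩
  · rfl
  · rfl
  · simp only [Sweeper.grow]
    split_ifs
    · rcases P.sweeper.turn (P.sweeper.pass q t).1 with _ | ⟨q', _ | u⟩ <;> rfl
    · rfl

/-- The local rule as a function of a triple of cells. -/
def rule (P : Program) (l c r : Cell (Bool × ℕ) ℕ) : Cell (Bool × ℕ) ℕ :=
  P.sweeper.next (fun d => bif d then r else l) c

/-- The arguments of the local rule. -/
abbrev RuleArgs : Type :=
  Program × Cell (Bool × ℕ) ℕ × Cell (Bool × ℕ) ℕ × Cell (Bool × ℕ) ℕ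

theorem primrec_rule : Primrec fun p : RuleArgs => p.1.rule p.2.1 p.2.2.1 p.2.2.2 := by
  have hl : Primrec fun p : RuleArgs => p.2.1 := Primrec.fst.comp .snd
  have hr : Primrec fun p : RuleArgs => p.2.2.2 := Primrec.snd.comp (Primrec.snd.comp .snd)
  have hgl := primrec_grow.comp (Primrec.fst.pair ((Primrec.const true).pair hl))
  have hgr := primrec_grow.comp (Primrec.fst.pair ((Primrec.const false).pair hr))
  have htape : Primrec fun p : (RuleArgs) × Bool × ℕ =>
      match (bif p.2.1 then p.1.2.2.2 else p.1.2.1) with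
      | blank => blank
      | tape s' _ => if s' = p.2.1 then tape p.2.1 p.2.2 else blank
      | head d q u => if d = p.2.1 then tape p.2.1 p.2.2 else
          (head d (p.1.1.sweeper.pass q u).1 p.2.2 : Cell (Bool × ℕ) ℕ) := by
    have ht : Primrec fun p : ((RuleArgs) × Bool × ℕ) => (tape p.2.1 p.2.2 : Cell (Bool × ℕ) ℕ) :=
      primrec_tape.comp (Primrec.fst.comp .snd) (Primrec.snd.comp .snd)
    have hnb : Primrec fun p : RuleArgs × Bool × ℕ => bif p.2.1 then p.1.2.2.2 else p.1.2.1 :=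
      Primrec.cond (Primrec.fst.comp .snd) (hr.comp .fst) (hl.comp .fst)
    refine (primrec_casesOn (h := fun p st => if st.1 = p.2.1 then tape p.2.1 p.2.2 else blank)
      (k := fun p x => if x.1 = p.2.1 then tape p.2.1 p.2.2 else
        head x.1 (p.1.1.sweeper.pass x.2.1 x.2.2).1 p.2.2) hnb (.const blank) ?_ ?_).of_eq
          fun p => by cases (bif p.2.1 then p.1.2.2.2 else p.1.2.1) <;> rfl
    · exact Primrec.ite (Primrec.eq.comp (Primrec.fst.comp .snd)
        (Primrec.fst.comp (Primrec.snd.comp .fst))) (ht.comp .fst) (.const blank)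
    · exact Primrec.ite (Primrec.eq.comp (Primrec.fst.comp .snd)
        (Primrec.fst.comp (Primrec.snd.comp .fst))) (ht.comp .fst)
        (primrec_head.comp ((Primrec.fst.comp .snd).pair ((Primrec.fst.comp (primrec_pass.comp
          ((Primrec.fst.comp (Primrec.fst.comp .fst)).pair (Primrec.snd.comp .snd)))).pair
            (Primrec.snd.comp (Primrec.snd.comp .fst)))))
  have hhead : Primrec fun p : (RuleArgs) × Bool × (Bool × ℕ) × ℕ =>
      match (bif p.2.1 then p.1.2.2.2 else p.1.2.1) with
      | blank =>
        match p.1.1.sweeper.turn (p.1.1.sweeper.pass p.2.2.1 p.2.2.2).1 with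
        | none => blank
        | some (q', none) => head (!p.2.1) q' (p.1.1.sweeper.pass p.2.2.1 p.2.2.2).2
        | some (_, some _) => tape p.2.1 (p.1.1.sweeper.pass p.2.2.1 p.2.2.2).2
      | tape s _ => if s = p.2.1 then blank else
        tape p.2.1 (p.1.1.sweeper.pass p.2.2.1 p.2.2.2).2
      | head _ _ _ => (blank : Cell (Bool × ℕ) ℕ) := by
    have hp : Primrec fun p : (RuleArgs) × Bool × (Bool × ℕ) × ℕ =>
        p.1.1.sweeper.pass p.2.2.1 p.2.2.2 :=
      primrec_pass.comp ((Primrec.fst.comp .fst).pair (Primrec.snd.comp .snd))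
    have hd : Primrec fun p : (RuleArgs) × Bool × (Bool × ℕ) × ℕ => p.2.1 := Primrec.fst.comp .snd
    have ht : Primrec fun p : (RuleArgs) × Bool × (Bool × ℕ) × ℕ =>
        (tape p.2.1 (p.1.1.sweeper.pass p.2.2.1 p.2.2.2).2 : Cell (Bool × ℕ) ℕ) :=
      primrec_tape.comp hd (Primrec.snd.comp hp)
    refine (primrec_casesOn (h := fun p st => if st.1 = p.2.1 then blank else
        tape p.2.1 (p.1.1.sweeper.pass p.2.2.1 p.2.2.2).2)
      (k := fun _ _ => blank)
      (Primrec.cond hd (hr.comp .fst) (hl.comp .fst))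
      (Primrec.option_casesOn (primrec_turn.comp ((Primrec.fst.comp .fst).pair
          (Primrec.fst.comp hp))) (.const blank)
        (Primrec.option_casesOn (Primrec.snd.comp .snd)
          (primrec_head.comp ((Primrec.not.comp (hd.comp .fst)).pair
            ((Primrec.fst.comp .snd).pair (Primrec.snd.comp (hp.comp .fst)))))
          (ht.comp (Primrec.fst.comp .fst)).to₂).to₂)
      (Primrec.ite (Primrec.eq.comp (Primrec.fst.comp .snd) (hd.comp .fst)) (.const blank)
        (ht.comp .fst)) (Primrec.const blank).to₂).of_eq ?_
    rintro ⟨⟨P, l, c, r⟩, d, q, t⟩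
    dsimp only
    cases (bif d then r else l) with
    | blank =>
      simp only
      rcases P.sweeper.turn (P.sweeper.pass q t).1 with _ | ⟨q', _ | u⟩ <;> rfl
    | tape s t => rfl
    | head d q t => rfl
  refine (primrec_casesOn (Primrec.fst.comp (Primrec.snd.comp .snd))
    (Primrec.option_casesOn hgl (Primrec.option_casesOn hgr (.const blank) Primrec.snd.to₂)
      (Primrec.option_casesOn (hgr.comp .fst) .snd (Primrec.const blank).to₂).to₂)
    htape.to₂ hhead.to₂).of_eq ?_
  rintro ⟨P, l, c, r⟩
  simp only [rule]
  cases c with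
  | blank =>
    simp only [Sweeper.next, cond_true, cond_false]
    rcases P.sweeper.grow true l with _ | c <;> rcases P.sweeper.grow false r with _ | c' <;> rfl
  | tape s t =>
    simp only [Sweeper.next]
    cases (bif s then r else l) <;> rfl
  | head d q t =>
    simp only [Sweeper.next]
    cases (bif d then r else l) with
    | blank => rcases P.sweeper.turn (P.sweeper.pass q t).1 with _ | ⟨q', _ | u⟩ <;> rfl
    | tape s t => rfl
    | head d q t => rfl

/-- A number that exceeds all registers and places that occur in the program. It is at least `2`, so
that register `1` is available for the input of a search. -/
def bound (P : Program) : ℕ :=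
  (P.map fun I => (I.map fun J : Instr => J.1 + J.2.1 + J.2.2.getD 0).getD 0).sum + 2

theorem primrec_bound : Primrec bound := by
  have hsum : Primrec (List.sum : List ℕ → ℕ) :=
    (Primrec.list_foldr .id (.const 0) (Primrec.nat_add.comp (Primrec.fst.comp .snd)
      (Primrec.snd.comp .snd)).to₂).of_eq fun l => by
        induction l with
        | nil => rfl
        | cons a l ih => simp_all
  refine Primrec.nat_add.comp (hsum.comp (Primrec.list_map .id (Primrec.option_getD.comp
    (Primrec.option_map .snd (Primrec.nat_add.comp (Primrec.nat_add.comp (Primrec.fst.comp .snd)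
      (Primrec.fst.comp (Primrec.snd.comp .snd)))
      (Primrec.option_getD.comp (Primrec.snd.comp (Primrec.snd.comp .snd)) (.const 0))).to₂)
    (.const 0)).to₂)) (.const 2)

theorem lt_bound {P : Program} {n i n' : ℕ} {m : Option ℕ} (h : P.fetch n = some (i, n', m)) :
    i < P.bound ∧ n' < P.bound ∧ ∀ k, m = some k → k < P.bound := by
  have hm : some (i, n', m) ∈ P := by
    unfold fetch at h
    rw [List.getD_eq_getElem?_getD] at h
    rcases hk : P[n]? with _ | I
    · simp [hk] at h
    · rw [hk] at h
      obtain rfl : I = some (i, n', m) := h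
      exact List.mem_of_getElem? hk
  have := List.le_sum_of_mem (List.mem_map_of_mem (f := fun I : Option Instr =>
    (I.map fun J : Instr => J.1 + J.2.1 + J.2.2.getD 0).getD 0) hm)
  simp only [Option.map_some, Option.getD_some] at this
  unfold bound
  refine ⟨by omega, by omega, ?_⟩
  rintro k rfl
  simp only [Option.getD_some] at this
  omega

/-- The cells in use: places of the program are below `B`, letters are at most `B`. -/
def Allowed (B : ℕ) : Cell (Bool × ℕ) ℕ → Prop
  | blank => True
  | tape _ t => t ≤ B
  | head _ q t => q.2 < B ∧ t ≤ B

theorem allowed_pass {P : Program} {q : Bool × ℕ} {t : ℕ} (hq : q.2 < P.bound)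
    (ht : t ≤ P.bound) :
    (P.sweeper.pass q t).1.2 < P.bound ∧ (P.sweeper.pass q t).2 ≤ P.bound := by
  simp only [sweeper]
  split
  · next h =>
    split_ifs
    · exact ⟨(lt_bound h).2.1, Nat.zero_le _⟩
    · exact ⟨hq, ht⟩
  · exact ⟨hq, ht⟩

theorem allowed_turn {P : Program} {q q' : Bool × ℕ} {u : Option ℕ} (hq : q.2 < P.bound)
    (h : P.sweeper.turn q = some (q', u)) :
    q'.2 < P.bound ∧ ∀ t, u = some t → t ≤ P.bound := by
  simp only [sweeper] at h
  split_ifs at h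
  · rcases hf : P.fetch q.2 with _ | ⟨i, n, _ | m⟩
    · simp [hf] at h
    · simp only [hf, Option.some.injEq, Prod.mk.injEq] at h
      obtain ⟨rfl, rfl⟩ := h
      have := lt_bound hf
      exact ⟨this.2.1, by rintro t ⟨⟩; exact this.1⟩
    · simp only [hf, Option.some.injEq, Prod.mk.injEq] at h
      obtain ⟨rfl, rfl⟩ := h
      exact ⟨(lt_bound hf).2.2 m rfl, by simp⟩
  · simp only [Option.some.injEq, Prod.mk.injEq] at h
    obtain ⟨rfl, rfl⟩ := h
    exact ⟨hq, by simp⟩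

theorem allowed_grow {P : Program} {d : Bool} {c c' : Cell (Bool × ℕ) ℕ} (hc : Allowed P.bound c)
    (h : P.sweeper.grow d c = some c') : Allowed P.bound c' := by
  unfold Sweeper.grow at h
  split at h
  · next d' q t =>
    split_ifs at h
    split at h
    · next q' u hq =>
      cases h
      have := allowed_turn (allowed_pass hc.1 hc.2).1 hq
      exact ⟨this.1, this.2 u rfl⟩
    · simp at h
  · simp at h

theorem allowed_rule {P : Program} {l c r : Cell (Bool × ℕ) ℕ} (hl : Allowed P.bound l)
    (hc : Allowed P.bound c) (hr : Allowed P.bound r) : Allowed P.bound (P.rule l c r) := by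
  have hnb : ∀ d : Bool, Allowed P.bound (bif d then r else l) := by
    rintro (_ | _) <;> assumption
  unfold rule
  cases c with
  | blank =>
    simp only [Sweeper.next]
    split
    · next h _ => exact allowed_grow (hnb _) h
    · next h => exact allowed_grow (hnb _) h
    · trivial
  | tape s t =>
    have hs := hnb s
    simp only [Sweeper.next]
    split
    · trivial
    · split_ifs
      · exact hc
      · trivial
    · next d q u hx =>
      rw [hx] at hs
      split_ifs
      · exact hc
      · exact ⟨(allowed_pass hs.1 hs.2).1, hc⟩
  | head d q t =>
    have hp := allowed_pass hc.1 hc.2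
    simp only [Sweeper.next]
    split
    · split
      · trivial
      · next h => exact ⟨(allowed_turn hp.1 h).1, hp.2⟩
      · exact hp.2
    · split_ifs
      · trivial
      · exact hp.2
    · trivial

/-- The list of the cells in use apart from the blank one. -/
def cells (B : ℕ) : List (Cell (Bool × ℕ) ℕ) :=
  ([false, true].flatMap fun d => (List.range (B + 1)).map (tape d)) ++
    [false, true].flatMap fun d => [false, true].flatMap fun b => (List.range B).flatMap fun n =>
      (List.range (B + 1)).map (head d (b, n))

theorem mem_cells {B : ℕ} {c : Cell (Bool × ℕ) ℕ} : c ∈ cells B ↔ c ≠ blank ∧ Allowed B c := by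
  rcases c with _ | ⟨s, t⟩ | ⟨d, ⟨b, n⟩, t⟩
  · simp [cells]
  · cases s <;> simp [cells, Allowed]
  · cases d <;> cases b <;> simp [cells, Allowed]

theorem primrec_cells : Primrec cells := by
  have hr : Primrec fun B : ℕ => List.range (B + 1) := Primrec.list_range.comp .succ
  refine Primrec.list_append.comp
    (Primrec.list_flatMap (.const _) (Primrec.list_map (hr.comp .fst)
      (primrec_tape.comp (Primrec.snd.comp .fst) .snd).to₂).to₂)
    (Primrec.list_flatMap (.const _) (Primrec.list_flatMap (.const _) (Primrec.list_flatMap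
      (Primrec.list_range.comp (Primrec.fst.comp .fst)) (Primrec.list_map
        (hr.comp (Primrec.fst.comp (Primrec.fst.comp .fst)))
        (primrec_head.comp ((Primrec.snd.comp (Primrec.fst.comp (Primrec.fst.comp .fst))).pair
          (((Primrec.snd.comp (Primrec.fst.comp .fst)).pair (Primrec.snd.comp .fst)).pair
            .snd))).to₂).to₂).to₂).to₂)

/-- The cell with number `i`; number `0` is the blank cell. -/
def decodeCell (P : Program) (i : ℕ) : Cell (Bool × ℕ) ℕ := (blank :: cells P.bound).getD i blank

/-- The number of a cell. -/
def encodeCell (P : Program) (c : Cell (Bool × ℕ) ℕ) : ℕ := (blank :: cells P.bound).idxOf c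

theorem primrec_decodeCell : Primrec₂ decodeCell :=
  (Primrec.list_getD blank).comp (Primrec.list_cons.comp (.const blank)
    (primrec_cells.comp (primrec_bound.comp .fst))) .snd

theorem primrec_encodeCell : Primrec₂ encodeCell :=
  Primrec.list_idxOf.comp .snd (Primrec.list_cons.comp (.const blank)
    (primrec_cells.comp (primrec_bound.comp .fst)))

theorem allowed_iff_mem {B : ℕ} {c : Cell (Bool × ℕ) ℕ} :
    Allowed B c ↔ c ∈ blank :: cells B := by
  rw [List.mem_cons, mem_cells]
  by_cases h : c = blank
  · subst h; simp [Allowed]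
  · simp [h]

theorem encodeCell_lt {P : Program} {c : Cell (Bool × ℕ) ℕ} (hc : Allowed P.bound c) :
    P.encodeCell c < (cells P.bound).length + 1 :=
  List.idxOf_lt_length_iff.2 (allowed_iff_mem.1 hc)

theorem decodeCell_encodeCell {P : Program} {c : Cell (Bool × ℕ) ℕ} (hc : Allowed P.bound c) :
    P.decodeCell (P.encodeCell c) = c := by
  rw [decodeCell, encodeCell, List.getD_eq_getElem _ _ (encodeCell_lt hc)]
  exact List.getElem_idxOf _

theorem allowed_decodeCell (P : Program) (i : ℕ) : Allowed P.bound (P.decodeCell i) := by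
  rw [decodeCell, List.getD_eq_getElem?_getD]
  rcases h : (blank :: cells P.bound)[i]? with _ | c
  · trivial
  · exact allowed_iff_mem.2 (List.mem_of_getElem? h)

theorem decodeCell_eq_blank {P : Program} {i : ℕ} (hi : i < (cells P.bound).length + 1) :
    P.decodeCell i = blank ↔ i = 0 := by
  cases i with
  | zero => simp [decodeCell]
  | succ i =>
    have hi' : i < (cells P.bound).length := by omega
    have : P.decodeCell (i + 1) = (cells P.bound)[i] := by
      simp [decodeCell, hi']
    rw [this]
    simpa using (mem_cells.1 (List.getElem_mem hi')).1

/-- The patterns of length three over `0, …, n - 1`. -/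
def patterns (n : ℕ) : List (List ℕ) :=
  (List.range n).flatMap fun i => (List.range n).flatMap fun j =>
    (List.range n).map fun k => [i, j, k]

theorem primrec_patterns : Primrec patterns := by
  refine Primrec.list_flatMap .list_range (Primrec.list_flatMap (Primrec.list_range.comp .fst)
    (Primrec.list_map (Primrec.list_range.comp (Primrec.fst.comp .fst))
      (Primrec.list_cons.comp (Primrec.snd.comp (Primrec.fst.comp .fst)) (Primrec.list_cons.comp
        (Primrec.snd.comp .fst) (Primrec.list_cons.comp .snd (.const [])))).to₂).to₂).to₂

/-- The local rule on the numbers of cells. -/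
def numRule (P : Program) (w : List ℕ) : ℕ :=
  P.encodeCell (P.rule (P.decodeCell (w.getD 0 0)) (P.decodeCell (w.getD 1 0))
    (P.decodeCell (w.getD 2 0)))

theorem primrec_numRule : Primrec₂ numRule := by
  have h : ∀ i : ℕ, Primrec fun p : Program × List ℕ => p.1.decodeCell (p.2.getD i 0) := fun i =>
    primrec_decodeCell.comp .fst ((Primrec.list_getD 0).comp .snd (.const i))
  exact primrec_encodeCell.comp .fst
    (primrec_rule.comp (Primrec.fst.pair ((h 0).pair ((h 1).pair (h 2)))))

/-- The description of the cellular automaton that runs the counter program `P`. -/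
def code (P : Program) : CACode :=
  ((cells P.bound).length, [[-1], [0], [1]],
    (patterns ((cells P.bound).length + 1)).map fun w => (w, P.numRule w))

theorem primrec_code : Primrec code := by
  have h : Primrec fun P : Program => (cells P.bound).length :=
    Primrec.list_length.comp (primrec_cells.comp primrec_bound)
  exact h.pair ((Primrec.const _).pair (Primrec.list_map
    (primrec_patterns.comp (Primrec.succ.comp h))
    (Primrec.snd.pair primrec_numRule).to₂))

/-- The first unit vector. -/
abbrev unitVec (d : ℕ) : Fin d → ℤ := CACode.vec d [1]

theorem not_isOfFinAddOrder_unitVec {d : ℕ} (hd : 1 ≤ d) : ¬ IsOfFinAddOrder (unitVec d) := by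
  rw [isOfFinAddOrder_iff_nsmul_eq_zero]
  rintro ⟨n, hn, h⟩
  have := congrFun h ⟨0, hd⟩
  simp [CACode.vec] at this
  omega

/-- The configuration of cells given by a configuration of the described automaton. -/
def toCells (P : Program) {d : ℕ} (x : (Fin d → ℤ) → Fin (P.code.1 + 1)) :
    (Fin d → ℤ) → Cell (Bool × ℕ) ℕ := fun v => P.decodeCell (x v).val

theorem toCells_globalMap (P : Program) {d : ℕ} (x : (Fin d → ℤ) → Fin (P.code.1 + 1)) :
    P.toCells ((CACode.toCA d P.code).globalMap x) =
      P.sweeper.evolve (unitVec d) (P.toCells x) := by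
  funext v
  have hneg : CACode.vec d [-1] = -unitVec d := by
    funext i; rcases i with ⟨_ | i, hi⟩ <;> simp [CACode.vec]
  have hzero : CACode.vec d [0] = 0 := by
    funext i; rcases i with ⟨_ | i, hi⟩ <;> simp [CACode.vec]
  have hpat : (P.code.2.1.attach.map fun l => (x (v + CACode.vec d l.1)).val) =
      [(x (v + -unitVec d)).val, (x v).val, (x (v + unitVec d)).val] := by
    rw [List.attach_map_val (l := P.code.2.1) (f := fun l => (x (v + CACode.vec d l)).val)]
    simp [code, hneg, hzero]
  set w := [(x (v + -unitVec d)).val, (x v).val, (x (v + unitVec d)).val] with hw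
  have hmem : w ∈ patterns ((cells P.bound).length + 1) := by
    simp only [patterns, List.mem_flatMap, List.mem_map, List.mem_range]
    exact ⟨_, (x (v + -unitVec d)).isLt, _, (x v).isLt, _, (x (v + unitVec d)).isLt, rfl⟩
  have hval : (((CACode.toCA d P.code).globalMap x) v).val = P.numRule w := by
    change (CACode.next P.code.1 P.code.2.2
      (P.code.2.1.attach.map fun l => (x (v + CACode.vec d l.1)).val)).val = _
    rw [hpat, CACode.next]
    simp only [code]
    rw [List.lookup_graph _ hmem, Option.getD_some]
    refine Nat.mod_eq_of_lt (encodeCell_lt (allowed_rule ?_ ?_ ?_)) <;>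
      exact allowed_decodeCell _ _
  unfold toCells
  rw [hval, numRule, decodeCell_encodeCell (allowed_rule (allowed_decodeCell _ _)
    (allowed_decodeCell _ _) (allowed_decodeCell _ _)), rule, Sweeper.evolve]
  congr 1
  funext s
  cases s <;> rfl

theorem toCells_iterate_globalMap (P : Program) {d : ℕ}
    (x : (Fin d → ℤ) → Fin (P.code.1 + 1)) (n : ℕ) :
    P.toCells ((CACode.toCA d P.code).globalMap^[n] x) =
      (P.sweeper.evolve (unitVec d))^[n] (P.toCells x) := by
  induction n with
  | zero => rfl
  | succ n ih => rw [Function.iterate_succ_apply', Function.iterate_succ_apply',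
      toCells_globalMap, ih]

theorem toCells_apply_eq_blank (P : Program) {d : ℕ} (x : (Fin d → ℤ) → Fin (P.code.1 + 1))
    (v : Fin d → ℤ) : P.toCells x v = blank ↔ x v = 0 := by
  rw [toCells, decodeCell_eq_blank (x v).isLt, Fin.ext_iff]; rfl

theorem toCells_eq_blank (P : Program) {d : ℕ} (x : (Fin d → ℤ) → Fin (P.code.1 + 1)) :
    (P.toCells x = fun _ => blank) ↔ x = fun _ => 0 := by
  simp [funext_iff, toCells_apply_eq_blank]

theorem finitelyNilpotent_code {P : Program} {d : ℕ} (hd : 1 ≤ d) (hP : ∀ c, Halts P.step c) :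
    (CACode.toCA d P.code).FinitelyNilpotent 0 := by
  refine ⟨?_, fun x hx => ?_⟩
  · rw [← toCells_eq_blank, toCells_globalMap, (toCells_eq_blank P _).2 rfl]
    exact Sweeper.evolve_const_blank
  · obtain ⟨n, hn⟩ := Sweeper.exists_iterate_eq_blank (M := P.sweeper) (x := P.toCells x)
      (not_isOfFinAddOrder_unitVec hd) (halts_sweeper_of_forall_halts hP)
      (by simpa [toCells_apply_eq_blank, CellularAutomaton.IsFiniteConfig] using hx)
    exact ⟨n, by rw [← toCells_eq_blank, toCells_iterate_globalMap, hn]⟩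

open Classical in
/-- A word that consists of a head and `m` letters `u` ahead of it. -/
noncomputable def initial {A : Type} [AddCommGroup A] (e : A) (n u m : ℕ) (v : A) :
    Cell (Bool × ℕ) ℕ :=
  if v = 0 then head true (true, n) 0 else
    if ∃ k : ℕ, k ≤ m ∧ v = k • e then tape false u else blank

theorem rep_initial {A : Type} [AddCommGroup A] {e : A} (he : ¬ IsOfFinAddOrder e) (n u m : ℕ) :
    Sweeper.Rep e (Sweeper.EndsBlank e (Γ := ℕ)) (initial e n u m) 0 true
      ((true, n), 0, List.replicate m u, []) := by
  have hinj : ∀ {i j : ℕ}, i • e = j • e → i = j := fun h =>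
    injective_nsmul_iff_not_isOfFinAddOrder.2 he h
  refine ⟨by simp [initial], ?_, fun k => ?_⟩
  · have key : ∀ j i : ℕ, i + j = m → Sweeper.Side e
        (Sweeper.EndsBlank e (initial e n u m)) (initial e n u m) (List.replicate j u)
        (i • e) true := by
      intro j
      induction j with
      | zero =>
        intro i hi k
        have h1 : i • e + (k + 1) • Sweeper.dir e true = (i + k + 1) • e := by
          simp [Sweeper.dir, add_nsmul, add_assoc]
        have h2 : (i + k + 1) • e ≠ 0 := fun h => by
          have := hinj (h.trans (zero_nsmul e).symm); omega
        have h3 : ¬ ∃ k' : ℕ, k' ≤ m ∧ (i + k + 1) • e = k' • e := by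
          rintro ⟨k', hk', h⟩
          have := hinj h; omega
        rw [h1, initial, if_neg h2, if_neg h3]
      | succ j ih =>
        intro i hi
        have h1 : i • e + Sweeper.dir e true = (i + 1) • e := by
          simp [Sweeper.dir, add_nsmul]
        have h2 : (i + 1) • e ≠ 0 := fun h => by
          have := hinj (h.trans (zero_nsmul e).symm); omega
        rw [List.replicate_succ]
        refine ⟨?_, by rw [h1]; exact ih (i + 1) (by omega)⟩
        rw [h1, initial, if_neg h2, if_pos ⟨i + 1, by omega, rfl⟩, Bool.not_true]
    simpa using key m 0 (zero_add m)
  · have h1 : (0 : A) + (k + 1) • Sweeper.dir e (!true) = -((k + 1) • e) := by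
      simp [Sweeper.dir]
    have h2 : -((k + 1) • e) ≠ 0 := fun h => by
      have := hinj ((neg_eq_zero.1 h).trans (zero_nsmul e).symm); omega
    have h3 : ¬ ∃ k' : ℕ, k' ≤ m ∧ -((k + 1) • e) = k' • e := by
      rintro ⟨k', -, h⟩
      have h4 : (k' + (k + 1)) • e = 0 := by rw [add_nsmul, ← h]; simp
      have := hinj (h4.trans (zero_nsmul e).symm); omega
    rw [h1, initial, if_neg h2, if_neg h3]

theorem not_finitelyNilpotent_code {P : Program} {d : ℕ} (hd : 1 ≤ d) {n i m : ℕ}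
    (hn : n < P.bound) (hi : i < P.bound)
    (hP : ¬ Halts P.step (n, Function.update (0 : ℕ → ℕ) i m)) :
    ¬ (CACode.toCA d P.code).FinitelyNilpotent 0 := by
  rintro ⟨-, h⟩
  have hcont : contents (0 :: List.replicate m (i + 1)) = Function.update (0 : ℕ → ℕ) i m := by
    funext j
    by_cases hj : j = i
    · subst hj; simp [contents]
    · simp [contents, hj, List.count_replicate, Ne.symm hj]
  let y := initial (unitVec d) n (i + 1) m
  have hy : ∀ v, Allowed P.bound (y v) := fun v => by
    simp only [y, initial]
    split_ifs
    · exact ⟨hn, Nat.zero_le _⟩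
    · exact hi
    · trivial
  let x : (Fin d → ℤ) → Fin (P.code.1 + 1) := fun v => ⟨P.encodeCell (y v), encodeCell_lt (hy v)⟩
  have hxy : P.toCells x = y := funext fun v => decodeCell_encodeCell (hy v)
  have hfin : CellularAutomaton.IsFiniteConfig 0 x := by
    refine ((Set.finite_Iic m).image fun k : ℕ => k • unitVec d).subset fun v hv => ?_
    have hv' : y v ≠ blank := by rw [← hxy, Ne, toCells_apply_eq_blank]; exact hv
    simp only [y, initial] at hv'
    split_ifs at hv' with h0 h1
    · exact ⟨0, by simp, by simp [h0]⟩
    · obtain ⟨k, hk, rfl⟩ := h1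
      exact ⟨k, hk, rfl⟩
    · exact absurd rfl hv'
  obtain ⟨k, hk⟩ := h x hfin
  rw [← toCells_eq_blank, toCells_iterate_globalMap, hxy] at hk
  refine Sweeper.iterate_ne_blank (rep_initial (not_isOfFinAddOrder_unitVec hd) n (i + 1) m)
    (fun h => hP ?_) k hk
  rw [← hcont]
  exact halts_of_halts_sweeper h

end Program

/-! ### Simulation of a cellular automaton on finite configurations -/

theorem Int.primrec_toNat : Primrec Int.toNat := by
  have h : Primrec fun z : ℤ =>
      if Encodable.encode z % 2 = 0 then Encodable.encode z / 2 else 0 :=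
    Primrec.ite (Primrec.eq.comp (Primrec.nat_mod.comp .encode (.const 2)) (.const 0))
      (Primrec.nat_div.comp .encode (.const 2)) (.const 0)
  refine h.of_eq fun z => ?_
  cases z with
  | ofNat n =>
    have : Encodable.encode (Int.ofNat n) = 2 * n := rfl
    rw [this, if_pos (by omega)]; simp
  | negSucc n =>
    have : Encodable.encode (Int.negSucc n) = 2 * n + 1 := rfl
    rw [this, if_neg (by omega)]; rfl

theorem Int.primrec_toNat_neg : Primrec fun z : ℤ => (-z).toNat := by
  have h : Primrec fun z : ℤ =>
      if Encodable.encode z % 2 = 0 then 0 else Encodable.encode z / 2 + 1 :=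
    Primrec.ite (Primrec.eq.comp (Primrec.nat_mod.comp .encode (.const 2)) (.const 0))
      (.const 0) (Primrec.succ.comp (Primrec.nat_div.comp .encode (.const 2)))
  refine h.of_eq fun z => ?_
  cases z with
  | ofNat n =>
    have : Encodable.encode (Int.ofNat n) = 2 * n := rfl
    rw [this, if_pos (by omega)]; simp
  | negSucc n =>
    have : Encodable.encode (Int.negSucc n) = 2 * n + 1 := rfl
    rw [this, if_neg (by omega), Int.neg_negSucc]
    simp; omega

theorem Int.primrec_natCast_sub : Primrec₂ fun m n : ℕ => (m : ℤ) - n := by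
  have h : Primrec₂ fun m n : ℕ =>
      Denumerable.ofNat ℤ (if n ≤ m then 2 * (m - n) else 2 * (n - m - 1) + 1) :=
    (Primrec.ofNat ℤ).comp (Primrec.ite (Primrec.nat_le.comp .snd .fst)
      (Primrec.nat_mul.comp (.const 2) (Primrec.nat_sub.comp .fst .snd))
      (Primrec.succ.comp (Primrec.nat_mul.comp (.const 2) (Primrec.nat_sub.comp
        (Primrec.nat_sub.comp .snd .fst) (.const 1)))))
  refine h.of_eq fun m n => ?_
  split_ifs with hmn
  · have : (m : ℤ) - n = Int.ofNat (m - n) := by simp [Nat.cast_sub hmn]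
    rw [this]
    exact Denumerable.ofNat_encode (Int.ofNat (m - n))
  · have : (m : ℤ) - n = Int.negSucc (n - m - 1) := by
      rw [Int.negSucc_eq]; omega
    rw [this]
    exact Denumerable.ofNat_encode (Int.negSucc (n - m - 1))

theorem Int.primrec_sub : Primrec₂ fun a b : ℤ => a - b :=
  (Int.primrec_natCast_sub.comp
    (Primrec.nat_add.comp (Int.primrec_toNat.comp .fst) (Int.primrec_toNat_neg.comp .snd))
    (Primrec.nat_add.comp (Int.primrec_toNat_neg.comp .fst) (Int.primrec_toNat.comp .snd))).of_eq
    fun ⟨a, b⟩ => by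
      have h1 := Int.toNat_sub_toNat_neg a
      have h2 := Int.toNat_sub_toNat_neg b
      push_cast
      omega

theorem Int.primrec_add : Primrec₂ fun a b : ℤ => a + b :=
  (Int.primrec_sub.comp .fst (Int.primrec_sub.comp (.const 0) .snd)).of_eq fun ⟨a, b⟩ => by
    dsimp only; omega

namespace CACode

/-- A finite configuration, given as a list of places with the numbers of their states; the first
entry for a place counts, and all other places are blank. -/
abbrev ConfList : Type := List (List ℤ × ℕ)

/-- The number listed for a place. -/
def value (X : ConfList) (q : List ℤ) : ℕ := (X.lookup q).getD 0

/-- The configuration with states `0, …, k` described by a list. -/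
def conf (d k : ℕ) (X : ConfList) (v : Fin d → ℤ) : Fin (k + 1) :=
  Fin.ofNat (k + 1) (value X (List.ofFn v))

/-- Coordinatewise combination of the vectors of `ℤ ^ d` listed by `l` and `l'`. -/
def zip (g : ℤ → ℤ → ℤ) (d : ℕ) (l l' : List ℤ) : List ℤ :=
  (List.range d).map fun i => g (l.getD i 0) (l'.getD i 0)

theorem zip_eq (g : ℤ → ℤ → ℤ) (d : ℕ) (l l' : List ℤ) :
    zip g d l l' = List.ofFn fun i => g (vec d l i) (vec d l' i) := by
  refine List.ext_getElem (by simp [zip]) fun i h1 h2 => ?_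
  simp [zip, vec]

theorem vec_ofFn {d : ℕ} (v : Fin d → ℤ) : vec d (List.ofFn v) = v := by
  funext i; simp [vec]

/-- The new state at the place `q`, computed from a listed configuration. -/
def newState (d : ℕ) (c : CACode) (X : ConfList) (q : List ℤ) : ℕ :=
  (next c.1 c.2.2 (c.2.1.map fun n => value X (zip (· + ·) d q n) % (c.1 + 1))).val

/-- The places at which the configuration listed by `X` may have an effect in the next step. -/
def places (d : ℕ) (c : CACode) (X : ConfList) : List (List ℤ) :=
  X.flatMap fun p => c.2.1.map fun n => zip (· - ·) d p.1 n

/-- One step of the described automaton on listed configurations. -/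
def stepList (d : ℕ) (c : CACode) (X : ConfList) : ConfList :=
  (places d c X).map fun q => (q, newState d c X q)

/-- The blank state of the described automaton is quiescent. -/
def Quiescent (c : CACode) : Prop := (next c.1 c.2.2 (c.2.1.map fun _ => 0)).val = 0

theorem globalMap_apply (d : ℕ) (c : CACode) (x : (Fin d → ℤ) → Fin (c.1 + 1)) (v : Fin d → ℤ) :
    (toCA d c).globalMap x v = next c.1 c.2.2 (c.2.1.map fun n => (x (v + vec d n)).val) := by
  rw [← List.attach_map_val (l := c.2.1) (f := fun n => (x (v + vec d n)).val)]
  rfl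

theorem quiescent_iff (d : ℕ) (c : CACode) :
    Quiescent c ↔ (toCA d c).globalMap (fun _ => 0) = fun _ => 0 := by
  rw [funext_iff]
  simp only [globalMap_apply, Quiescent, Fin.ext_iff, Fin.val_zero]
  exact ⟨fun h _ => h, fun h => h 0⟩

theorem conf_stepList {d : ℕ} {c : CACode} (hq : Quiescent c) (X : ConfList) :
    conf d c.1 (stepList d c X) = (toCA d c).globalMap (conf d c.1 X) := by
  funext v
  rw [globalMap_apply]
  have hstate : newState d c X (List.ofFn v) =
      (next c.1 c.2.2 (c.2.1.map fun n => (conf d c.1 X (v + vec d n)).val)).val := by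
    simp only [newState, conf, zip_eq, vec_ofFn]
    rfl
  by_cases hv : List.ofFn v ∈ places d c X
  · have : value (stepList d c X) (List.ofFn v) = newState d c X (List.ofFn v) := by
      rw [value, stepList, List.lookup_graph _ hv, Option.getD_some]
    rw [conf, this, hstate]
    exact Fin.ext (Nat.mod_eq_of_lt (Fin.isLt _))
  · have h0 : value (stepList d c X) (List.ofFn v) = 0 := by
      rw [value, List.lookup_eq_none_iff.2, Option.getD_none]
      intro p hp
      obtain ⟨q, hq, rfl⟩ := List.mem_map.1 hp
      simp only [bne_iff_ne]
      rintro rfl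
      exact hv hq
    have h1 : (c.2.1.map fun n => (conf d c.1 X (v + vec d n)).val) = c.2.1.map fun _ => 0 := by
      refine List.map_congr_left fun n hn => ?_
      by_contra hne
      have hval : value X (List.ofFn (v + vec d n)) ≠ 0 := fun h => hne (by simp [conf, h])
      rcases hl : X.lookup (List.ofFn (v + vec d n)) with _ | s
      · simp [value, hl] at hval
      · have hmem : (List.ofFn (v + vec d n), s) ∈ X := by
          obtain ⟨l₁, l₂, rfl, -⟩ := List.lookup_eq_some_iff.1 hl
          simp
        refine hv (List.mem_flatMap.2 ⟨_, hmem, List.mem_map.2 ⟨n, hn, ?_⟩⟩)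
        simp [zip_eq, vec_ofFn]
    rw [h1, conf, h0]
    exact Fin.ext (by rw [hq]; simp)

/-- All places of the list are blank. -/
def BlankList (d k : ℕ) (X : ConfList) : Prop :=
  ∀ p ∈ X, value X (zip (fun a _ => a) d p.1 []) % (k + 1) = 0

theorem mem_of_value_ne_zero {X : ConfList} {q : List ℤ} (h : value X q ≠ 0) :
    ∃ s, (q, s) ∈ X := by
  rcases hl : X.lookup q with _ | s
  · simp [value, hl] at h
  · obtain ⟨l₁, l₂, rfl, -⟩ := List.lookup_eq_some_iff.1 hl
    exact ⟨s, by simp⟩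

theorem blankList_iff {d k : ℕ} {X : ConfList} :
    BlankList d k X ↔ conf d k X = fun _ => 0 := by
  constructor
  · intro h
    funext v
    by_contra hne
    obtain ⟨s, hs⟩ := mem_of_value_ne_zero (X := X) (q := List.ofFn v)
      fun h => hne (by simp [conf, h])
    have := h _ hs
    rw [zip_eq] at this
    simp only [vec_ofFn] at this
    exact hne (Fin.ext (by simpa [conf] using this))
  · intro h p _
    rw [zip_eq]
    exact congrArg Fin.val (congrFun h (vec d p.1))

theorem isFiniteConfig_conf (d k : ℕ) (X : ConfList) :
    CellularAutomaton.IsFiniteConfig 0 (conf d k X) := by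
  refine ((X.map fun p => vec d p.1).toFinset.finite_toSet).subset fun v hv => ?_
  obtain ⟨s, hs⟩ := mem_of_value_ne_zero (X := X) (q := List.ofFn v)
    fun h => hv (by simp [conf, h])
  simp only [List.coe_toFinset, List.mem_map, Set.mem_ofPred_eq]
  exact ⟨_, hs, vec_ofFn v⟩

theorem exists_conf_eq {d k : ℕ} {x : (Fin d → ℤ) → Fin (k + 1)}
    (hx : CellularAutomaton.IsFiniteConfig 0 x) : ∃ X, conf d k X = x := by
  replace hx : {v | x v ≠ 0}.Finite := hx
  refine ⟨(hx.toFinset.toList.map List.ofFn).map fun q => (q, (x (vec d q)).val), ?_⟩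
  funext v
  by_cases hv : x v = 0
  · have : ¬ List.ofFn v ∈ hx.toFinset.toList.map List.ofFn := by
      simp only [List.mem_map, Finset.mem_toList, Set.Finite.mem_toFinset]
      rintro ⟨w, hw, hwv⟩
      exact hw (by rw [List.ofFn_injective hwv]; exact hv)
    rw [conf, value, List.lookup_eq_none_iff.2, hv]
    · rfl
    · intro p hp
      obtain ⟨q, hq, rfl⟩ := List.mem_map.1 hp
      simp only [bne_iff_ne]
      rintro rfl
      exact this hq
  · have : List.ofFn v ∈ hx.toFinset.toList.map List.ofFn :=
      List.mem_map_of_mem (by simpa using hv)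
    rw [conf, value, List.lookup_graph _ this, Option.getD_some, vec_ofFn]
    exact Fin.ext (Nat.mod_eq_of_lt (x v).isLt)

theorem conf_iterate_stepList {d : ℕ} {c : CACode} (hq : Quiescent c) (X : ConfList) (n : ℕ) :
    conf d c.1 ((stepList d c)^[n] X) = (toCA d c).globalMap^[n] (conf d c.1 X) := by
  induction n with
  | zero => rfl
  | succ n ih => rw [Function.iterate_succ_apply', Function.iterate_succ_apply',
      conf_stepList hq, ih]

theorem finitelyNilpotent_iff (d : ℕ) (c : CACode) : (toCA d c).FinitelyNilpotent 0 ↔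
    Quiescent c ∧ ∀ X, ∃ n, BlankList d c.1 ((stepList d c)^[n] X) := by
  rw [CellularAutomaton.FinitelyNilpotent, ← quiescent_iff]
  refine and_congr_right fun hq => ?_
  simp only [blankList_iff, conf_iterate_stepList hq]
  constructor
  · exact fun h X => h _ (isFiniteConfig_conf d c.1 X)
  · intro h x hx
    obtain ⟨X, rfl⟩ := exists_conf_eq hx
    exact h X

theorem primrec_lookup {α β : Type} [Primcodable α] [Primcodable β] [DecidableEq α] [BEq α]
    [LawfulBEq α] : Primrec₂ (List.lookup : α → List (α × β) → Option β) := by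
  have h : ‹BEq α› = instBEqOfDecidableEq := lawful_beq_subsingleton _ _
  subst h
  exact Primrec.listLookup

theorem primrec_value : Primrec₂ value :=
  Primrec.option_getD.comp (primrec_lookup.comp .snd .fst) (.const 0)

theorem primrec_zip {α : Type} [Primcodable α] {g : ℤ → ℤ → ℤ} (hg : Primrec₂ g) {d : α → ℕ}
    {l l' : α → List ℤ} (hd : Primrec d) (hl : Primrec l) (hl' : Primrec l') :
    Primrec fun a => zip g (d a) (l a) (l' a) := by
  have h := Primrec.list_getD (0 : ℤ)
  exact Primrec.list_map (Primrec.list_range.comp hd)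
    (hg.comp (h.comp (hl.comp .fst) .snd) (h.comp (hl'.comp .fst) .snd)).to₂

theorem primrec_next {α : Type} [Primcodable α] {k : α → ℕ} {T : α → List (List ℕ × ℕ)}
    {w : α → List ℕ} (hk : Primrec k) (hT : Primrec T) (hw : Primrec w) :
    Primrec fun a => (next (k a) (T a) (w a)).val :=
  Primrec.nat_mod.comp (Primrec.option_getD.comp (primrec_lookup.comp hw hT) (.const 0))
    (Primrec.succ.comp hk)

theorem primrec_newState {α : Type} [Primcodable α] {d : α → ℕ} {c : α → CACode}
    {X : α → ConfList} {q : α → List ℤ} (hd : Primrec d) (hc : Primrec c) (hX : Primrec X)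
    (hq : Primrec q) : Primrec fun a => newState (d a) (c a) (X a) (q a) := by
  have hk : Primrec fun a => (c a).1 := Primrec.fst.comp hc
  have hN : Primrec fun a => (c a).2.1 := Primrec.fst.comp (Primrec.snd.comp hc)
  have hT : Primrec fun a => (c a).2.2 := Primrec.snd.comp (Primrec.snd.comp hc)
  have hv : Primrec₂ fun (a : α) (n : List ℤ) =>
      value (X a) (zip (· + ·) (d a) (q a) n) % ((c a).1 + 1) :=
    Primrec.nat_mod.comp (primrec_value.comp (hX.comp .fst)
      (primrec_zip Int.primrec_add (hd.comp .fst) (hq.comp .fst) .snd))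
      (Primrec.succ.comp (hk.comp .fst))
  exact primrec_next hk hT (Primrec.list_map hN hv)

theorem primrec_stepList {α : Type} [Primcodable α] {d : α → ℕ} {c : α → CACode}
    {X : α → ConfList} (hd : Primrec d) (hc : Primrec c) (hX : Primrec X) :
    Primrec fun a => stepList (d a) (c a) (X a) := by
  have hN : Primrec fun a => (c a).2.1 := Primrec.fst.comp (Primrec.snd.comp hc)
  have hzip : Primrec₂ fun (z : α × List ℤ × ℕ) (n : List ℤ) => zip (· - ·) (d z.1) z.2.1 n :=
    primrec_zip Int.primrec_sub (hd.comp (Primrec.fst.comp .fst))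
      (Primrec.fst.comp (Primrec.snd.comp .fst)) .snd
  have hmap : Primrec₂ fun (a : α) (p : List ℤ × ℕ) =>
      (c a).2.1.map fun n => zip (· - ·) (d a) p.1 n :=
    Primrec.list_map (hN.comp .fst) hzip
  have hplaces : Primrec fun a => places (d a) (c a) (X a) := Primrec.list_flatMap hX hmap
  have hnew : Primrec₂ fun (a : α) (q : List ℤ) => (q, newState (d a) (c a) (X a) q) :=
    Primrec.snd.pair (primrec_newState (hd.comp .fst) (hc.comp .fst) (hX.comp .fst) .snd)
  exact Primrec.list_map hplaces hnew

theorem primrecPred_quiescent : PrimrecPred Quiescent := by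
  exact Primrec.eq.comp (primrec_next .fst (Primrec.snd.comp .snd)
    (Primrec.list_map (Primrec.fst.comp .snd) (Primrec.const 0).to₂)) (.const 0)

theorem primrecPred_blankList : PrimrecPred fun p : (ℕ × ℕ) × ConfList =>
    BlankList p.1.1 p.1.2 p.2 := by
  have h : PrimrecRel fun (p : List ℤ × ℕ) (b : (ℕ × ℕ) × ConfList) =>
      value b.2 (zip (fun a _ => a) b.1.1 p.1 []) % (b.1.2 + 1) = 0 := by
    exact Primrec.eq.comp (Primrec.nat_mod.comp (primrec_value.comp (Primrec.snd.comp .snd)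
      (primrec_zip Primrec.fst.to₂ (Primrec.fst.comp (Primrec.fst.comp .snd))
        (Primrec.fst.comp .fst) (.const [])))
      (Primrec.succ.comp (Primrec.snd.comp (Primrec.fst.comp .snd)))) (.const 0)
  exact h.forall_mem_list.comp .snd .id

end CACode

/-! ### Completeness -/

theorem IsPi02.comp {α β : Type} [Primcodable α] [Primcodable β] {p : β → Prop} (hp : IsPi02 p)
    {f : α → β} (hf : Computable f) : IsPi02 fun a => p (f a) := by
  obtain ⟨R, ⟨hd, hR⟩, h⟩ := hp
  refine ⟨fun z => R (f z.1, z.2), ⟨fun z => hd _, ?_⟩, fun a => h (f a)⟩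
  exact hR.comp ((hf.comp .fst).pair .snd)

theorem isPi02_finitelyNilpotent : IsPi02 fun c : ℕ × CACode =>
    1 ≤ c.1 ∧ (CACode.toCA c.1 c.2).FinitelyNilpotent 0 := by
  refine ⟨fun z => 1 ≤ z.1.1 ∧ CACode.Quiescent z.1.2 ∧ CACode.BlankList z.1.1 z.1.2.1
    ((CACode.stepList z.1.1 z.1.2)^[z.2.2] ((Encodable.decode z.2.1).getD [])), ?_, ?_⟩
  · have h1 : PrimrecPred fun z : (ℕ × CACode) × ℕ × ℕ => 1 ≤ z.1.1 :=
      Primrec.nat_le.comp (.const 1) (Primrec.fst.comp .fst)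
    have h2 : PrimrecPred fun z : (ℕ × CACode) × ℕ × ℕ => CACode.Quiescent z.1.2 :=
      CACode.primrecPred_quiescent.comp (Primrec.snd.comp .fst)
    have h3 : Primrec fun z : (ℕ × CACode) × ℕ × ℕ =>
        (CACode.stepList z.1.1 z.1.2)^[z.2.2] ((Encodable.decode z.2.1).getD []) :=
      Primrec.nat_iterate (Primrec.snd.comp .snd)
        (Primrec.option_getD.comp (Primrec.decode.comp (Primrec.fst.comp .snd)) (.const []))
        (CACode.primrec_stepList (Primrec.fst.comp (Primrec.fst.comp .fst))
          (Primrec.snd.comp (Primrec.fst.comp .fst)) .snd).to₂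
    have h4 : PrimrecPred fun z : (ℕ × CACode) × ℕ × ℕ => CACode.BlankList z.1.1 z.1.2.1
        ((CACode.stepList z.1.1 z.1.2)^[z.2.2] ((Encodable.decode z.2.1).getD [])) :=
      CACode.primrecPred_blankList.comp
        (((Primrec.fst.comp .fst).pair (Primrec.fst.comp (Primrec.snd.comp .fst))).pair h3)
    obtain ⟨hd, h⟩ := h1.and (h2.and h4)
    exact ⟨hd, h.to_comp⟩
  · rintro ⟨d, c⟩
    simp only [CACode.finitelyNilpotent_iff]
    constructor
    · rintro ⟨h1, h2, h3⟩ m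
      obtain ⟨n, hn⟩ := h3 ((Encodable.decode m).getD [])
      exact ⟨n, h1, h2, hn⟩
    · intro h
      obtain ⟨n, h1, h2, -⟩ := h 0
      refine ⟨h1, h2, fun X => ?_⟩
      obtain ⟨n, -, -, hn⟩ := h (Encodable.encode X)
      exact ⟨n, by simpa using hn⟩

/-- A normal form of `Π⁰₂` sets: the existential quantifier may be taken over the running time of a
computation, so that the matrix is primitive recursive and monotone. -/
theorem IsPi02.exists_primrec' {q : ℕ → Prop} (hq : IsPi02 q) :
    ∃ f : List.Vector ℕ 3 → ℕ, Nat.Primrec' f ∧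
      (∀ a, q a ↔ ∀ m, ∃ n, f (a ::ᵥ m ::ᵥ n ::ᵥ .nil) ≠ 0) ∧
      ∀ a m n n', n ≤ n' → f (a ::ᵥ m ::ᵥ n ::ᵥ .nil) ≠ 0 → f (a ::ᵥ m ::ᵥ n' ::ᵥ .nil) ≠ 0 := by
  obtain ⟨R, ⟨hd, hR⟩, h⟩ := hq
  let g : ℕ →. ℕ := fun x => Nat.rfind fun n => (decide (R (x.unpair.1, x.unpair.2, n)) : Part Bool)
  have hg : Partrec g := by
    refine Partrec.rfind (Computable₂.partrec₂ (f := fun x n : ℕ =>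
      decide (R (x.unpair.1, x.unpair.2, n))) ?_)
    exact hR.comp ((Computable.fst.comp (Computable.unpair.comp .fst)).pair
      ((Computable.snd.comp (Computable.unpair.comp .fst)).pair .snd))
  obtain ⟨c, hc⟩ := Nat.Partrec.Code.exists_code.1 (Partrec.nat_iff.1 hg)
  have hdom : ∀ a m, (∃ n, R (a, m, n)) ↔
      ∃ n, ∃ x, x ∈ Nat.Partrec.Code.evaln n c (Nat.pair a m) := by
    intro a m
    have h1 : (g (Nat.pair a m)).Dom ↔ ∃ n, R (a, m, n) := by
      refine Nat.rfind_dom.trans (exists_congr fun n => ?_)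
      simp
    rw [← h1, ← hc, Part.dom_iff_mem]
    simp only [Nat.Partrec.Code.evaln_complete]
    exact exists_comm
  refine ⟨fun v => if (Nat.Partrec.Code.evaln v.tail.tail.head c
    (Nat.pair v.head v.tail.head)).isSome then 1 else 0, ?_, fun a => ?_, fun a m n n' hn => ?_⟩
  · rw [Nat.Primrec'.prim_iff]
    have h1 : Primrec fun v : List.Vector ℕ 3 =>
        ((v.tail.tail.head, c), Nat.pair v.head v.tail.head) :=
      ((Primrec.vector_head.comp (Primrec.vector_tail.comp .vector_tail)).pair (.const c)).pair
        (Primrec₂.natPair.comp .vector_head (Primrec.vector_head.comp .vector_tail))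
    exact Primrec.ite (Primrec.eq.comp (Primrec.option_isSome.comp
      (Nat.Partrec.Code.primrec_evaln.comp h1)) (.const true)) (.const 1) (.const 0)
  · rw [h a]
    refine forall_congr' fun m => (hdom a m).trans (exists_congr fun n => ?_)
    simp [Option.isSome_iff_exists]
  · simp only [List.Vector.head_cons, List.Vector.tail_cons, ne_eq, ite_eq_right_iff, one_ne_zero,
      imp_false, not_not, Option.isSome_iff_exists]
    rintro ⟨x, hx⟩
    exact ⟨x, Nat.Partrec.Code.evaln_mono hn hx⟩

/-- A single description works in all dimensions: the automaton acts along the first coordinate. -/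
theorem IsPi02.exists_reduction {q : ℕ → Prop} (hq : IsPi02 q) :
    ∃ f : ℕ → CACode, Computable f ∧
      ∀ d, 1 ≤ d → ∀ a, q a ↔ (CACode.toCA d (f a)).FinitelyNilpotent 0 := by
  obtain ⟨f, hf, hqf, hmono⟩ := hq.exists_primrec'
  obtain ⟨body, hb⟩ := LoopProg.exists_computes hf (fun i => i.1) 3 4 (fun i => by omega)
    (by omega) fun i => by omega
  refine ⟨fun a => (body.searchProgram a).code,
    (Program.primrec_code.comp (LoopProg.primrec_searchProgram body)).to_comp,
    fun d hd a => ⟨fun h => ?_, fun h => ?_⟩⟩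
  · refine Program.finitelyNilpotent_code hd (LoopProg.halts_searchProgram hb fun m => ?_)
    obtain ⟨n, hn⟩ := (hqf a).1 h m
    exact ⟨n, fun n' hn' => hmono a m n n' hn' hn⟩
  · by_contra hqa
    rw [hqf] at hqa
    push Not at hqa
    obtain ⟨m, hm⟩ := hqa
    refine Program.not_finitelyNilpotent_code (i := 1) (m := m) hd
      ((Program.lt_bound (LoopProg.fetch_exit_add_one body a)).2.2 _ rfl)
      (by unfold Program.bound; omega)
      (LoopProg.not_halts_searchProgram hb (by simp) (by simpa using hm)) h

theorem mainTheorem4 :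
    (∀ d : ℕ, 1 ≤ d →
      IsPi02Complete fun c : CACode => (CACode.toCA d c).FinitelyNilpotent 0) ∧
    IsPi02Complete fun c : ℕ × CACode =>
      1 ≤ c.1 ∧ (CACode.toCA c.1 c.2).FinitelyNilpotent 0 := by
  refine ⟨fun d hd => ⟨?_, fun q hq => ?_⟩, isPi02_finitelyNilpotent, fun q hq => ?_⟩
  · have h := isPi02_finitelyNilpotent.comp (f := fun c : CACode => (d, c))
      ((Computable.const d).pair .id)
    simpa only [hd, true_and] using h
  · obtain ⟨f, hf, h⟩ := hq.exists_reduction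
    exact ⟨f, hf, h d hd⟩
  · obtain ⟨f, hf, h⟩ := hq.exists_reduction
    exact ⟨fun a => (1, f a), (Computable.const 1).pair hf, fun a => by
      simpa using h 1 le_rfl a⟩
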